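/- Let $m\ge 2$ and $n=5m+3$. The thin surface code on the $2\times m$ lattice, $m=(n-3)/5$, is the following stabilizer code. The lattice has vertices $(r,c)$, $0\le r\le 2$, $1\le c\le m$. The $n$ qubits sit on its edges: horizontal edges $h_{r,j}$ ($0\le r\le 2$, $0\le j\le m$), where $h_{r,j}$ joins $(r,j)$ to $(r,j+1)$ (for $j=0$ and $j=m$ one end dangles over the left or right rough boundary), and vertical edges $v_{r,c}$ ($0\le r\le 1$, $1\le c\le m$), where $v_{r,c}$ joins $(r,c)$ to $(r+1,c)$. The stabilizer group $\mathscr S$ is generated, all with positive sign, by the operators $X^{\otimes 4}$ or $X^{\otimes 3}$ on the existing edges among $h_{r,j},h_{r+1,j},v_{r,j},v_{r,j+1}$ around each face, and the operators $Z^{\otimes 4}$ or $Z^{\otimes 3}$ on the edges incident to each vertex. Let $\mathscr N(\mathscr S)$ be its normalizer in the Pauli group. **Estimation problem.** The qubits evolve by $$\frac{d\rho}{dt}=-i[H,\rho]+\sum_a\Big(L_a\rho L_a^\dagger-\tfrac12\{L_a^\dagger L_a,\rho\}\Big),\qquad H=\omega\sum_{i<j<k}Z_iZ_jZ_k+H_0,$$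 where $H_0$ is any $2$-local Hamiltonian and each of the finitely many $L_a$ acts nontrivially on one qubit only. A recovery is a quantum channel with outputs in the code space that maps $E\rho E^\dagger$ to a multiple of $\rho$, with a factor that depends only on $E$, for all code states $\rho$ and all single-qubit operators $E$. Starting from a code state, the recovery is applied at the times $t/M,2t/M,\dots,t$; the output state $\rho_\omega(t)$ is the limit as $M\to\infty$ (fast control limit). The output QFI is the maximum over the initial code states of the quantum Fisher information of $\rho_\omega(t)$ about $\omega$, defined by the symmetric logarithmic derivative. **Theorem.** The thin surface code is an $[[n,1,3]]$ stabilizer code, and exactly $(n+2)/5$ of the operators $Z_iZ_jZ_k$ with $i<j<k$ are logical operators, i.e. lie in $\mathscr N(\mathscr S)\setminus\mathscr S$. A recovery exists, and for every recovery, all $H_0$ and $L_a$ as above, every $\omega$ and every $t\ge 0$, the limit $\rho_\omega(t)$ exists for every initial code state and the output QFI is attained and equals $$\frac{4(n+2)^2t^2}{25}=\Theta(n^2t^2),$$ with absolute constants in $\Theta$. In particular it is $\Theta(t^2)$ as $t\to\infty$ for fixed $n$ (Heisenberg limit) and $\Theta(n^2)$ as $n\to\infty$ for fixed $t>0$ (Heisenberg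 scaling). -/

import Mathlib

open Filter Topology Asymptotics
open scoped Matrix

/-! ### Qubits and Pauli operators -/

/-- Operators on the Hilbert space `(ℂ²)^{⊗ Q}` of a finite set `Q` of qubits, as matrices in the
computational basis, whose elements are the bit strings `Q → Fin 2`. -/
abbrev Op (Q : Type) : Type := Matrix (Q → Fin 2) (Q → Fin 2) ℂ

/-- State vectors of the qubits `Q`. -/
abbrev Vec (Q : Type) : Type := (Q → Fin 2) → ℂ

/-- The single-qubit Pauli labels. -/
inductive Pauli : Type
  | I | X | Y | Z
  deriving DecidableEq

/-- The Pauli matrices. -/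
def Pauli.mat : Pauli → Matrix (Fin 2) (Fin 2) ℂ
  | .I => 1
  | .X => !![0, 1; 1, 0]
  | .Y => !![0, -Complex.I; Complex.I, 0]
  | .Z => !![1, 0; 0, -1]

lemma Pauli.mat_mul_self (p : Pauli) : p.mat * p.mat = 1 := by
  cases p <;> ext i j <;> fin_cases i <;> fin_cases j <;>
    simp [Pauli.mat, Matrix.mul_apply, Fin.sum_univ_two]

/-- The tensor product `⨂_q A q` of single-qubit operators. -/
def tensorOp {Q : Type} [Fintype Q] (A : Q → Matrix (Fin 2) (Fin 2) ℂ) : Op Q :=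
  Matrix.of fun x y => ∏ q, A q (x q) (y q)

lemma tensorOp_mul {Q : Type} [Fintype Q] [DecidableEq Q]
    (A B : Q → Matrix (Fin 2) (Fin 2) ℂ) :
    tensorOp A * tensorOp B = tensorOp fun q => A q * B q := by
  ext x y
  simp only [tensorOp, Matrix.mul_apply, Matrix.of_apply, ← Finset.prod_mul_distrib]
  rw [Finset.prod_univ_sum, Fintype.piFinset_univ]

lemma tensorOp_one {Q : Type} [Fintype Q] [DecidableEq Q] :
    tensorOp (fun _ : Q => 1) = (1 : Op Q) := by
  ext x y
  simp only [tensorOp, Matrix.of_apply, Matrix.one_apply]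
  by_cases h : x = y
  · simp [h]
  · rw [if_neg h]
    obtain ⟨q, hq⟩ := Function.ne_iff.mp h
    exact Finset.prod_eq_zero (Finset.mem_univ q) (if_neg hq)

/-- The operator acting as `A` on the qubit `q` and trivially on all other qubits. -/
def singleQubitOp {Q : Type} [Fintype Q] [DecidableEq Q] (q : Q)
    (A : Matrix (Fin 2) (Fin 2) ℂ) : Op Q :=
  tensorOp (Function.update (fun _ => 1) q A)

/-- The Pauli string `⨂_q p q`, as an operator. -/
def pauliOp {Q : Type} [Fintype Q] (p : Q → Pauli) : Op Q :=
  tensorOp fun q => (p q).mat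

/-- The Pauli string `⨂_q p q`, as an invertible operator. -/
def pauliUnit {Q : Type} [Fintype Q] [DecidableEq Q] (p : Q → Pauli) : (Op Q)ˣ where
  val := pauliOp p
  inv := pauliOp p
  val_inv := by simp [pauliOp, tensorOp_mul, Pauli.mat_mul_self, tensorOp_one]
  inv_val := by simp [pauliOp, tensorOp_mul, Pauli.mat_mul_self, tensorOp_one]

/-- The number of qubits on which a Pauli string acts nontrivially. -/
def pauliWeight {Q : Type} [Fintype Q] (p : Q → Pauli) : ℕ :=
  (Finset.univ.filter fun q => p q ≠ Pauli.I).card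

/-- The string with the Pauli operator `P` on the qubits of `T` and the identity elsewhere. -/
def pauliOn {Q : Type} [DecidableEq Q] (P : Pauli) (T : Finset Q) : Q → Pauli :=
  fun q => if q ∈ T then P else Pauli.I

/-- The scalar operator `i`. -/
noncomputable def phaseI (Q : Type) [Fintype Q] [DecidableEq Q] : (Op Q)ˣ :=
  Units.map (algebraMap ℂ (Op Q)).toMonoidHom (Units.mk0 Complex.I Complex.I_ne_zero)

/-- The Pauli group `{±1, ±i} × {I, X, Y, Z}^{⊗ Q}`. -/
noncomputable def pauliGroup (Q : Type) [Fintype Q] [DecidableEq Q] : Subgroup (Op Q)ˣ :=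
  Subgroup.closure (Set.range pauliUnit ∪ {phaseI Q})

/-! ### Stabilizer codes -/

/-- The code space: the states fixed by every stabilizer. -/
def codeSpace {Q : Type} [Fintype Q] [DecidableEq Q] (S : Subgroup (Op Q)ˣ) :
    Submodule ℂ (Vec Q) where
  carrier := {ψ | ∀ s ∈ S, (s : Op Q) *ᵥ ψ = ψ}
  zero_mem' := fun s _ => Matrix.mulVec_zero _
  add_mem' := fun ha hb s hs => by rw [Matrix.mulVec_add, ha s hs, hb s hs]
  smul_mem' := fun c ψ hψ s hs => by rw [Matrix.mulVec_smul, hψ s hs]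

/-- `S` is the stabilizer group of an `[[n, k, d]]` stabilizer code: an abelian subgroup of the
Pauli group of `n` qubits, whose code space has dimension `2 ^ k`, and such that `d` is the least
weight of a Pauli string that normalizes `S` and is not, up to a scalar factor, in `S`. -/
def IsStabilizerCode {Q : Type} [Fintype Q] [DecidableEq Q] (S : Subgroup (Op Q)ˣ)
    (n k d : ℕ) : Prop :=
  Fintype.card Q = n ∧
  S ≤ pauliGroup Q ∧
  (∀ a ∈ S, ∀ b ∈ S, a * b = b * a) ∧
  Module.finrank ℂ (codeSpace S) = 2 ^ k ∧
  IsLeast {w | ∃ p : Q → Pauli, pauliWeight p = w ∧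
    pauliUnit p ∈ Subgroup.normalizer (S : Set (Op Q)ˣ) ∧
    ∀ c : ℂ, ∀ s ∈ S, pauliOp p ≠ c • (s : Op Q)} d

/-- The sets `{i, j, k}` of three qubits for which `Z_i Z_j Z_k` is a logical operator, that is,
lies in the normalizer of the stabilizer group but not in the stabilizer group. -/
def zzzLogicals {Q : Type} [Fintype Q] [DecidableEq Q] (S : Subgroup (Op Q)ˣ) :
    Set (Finset Q) :=
  {T | T.card = 3 ∧ pauliUnit (pauliOn .Z T) ∈ Subgroup.normalizer (S : Set (Op Q)ˣ) ∧
    pauliUnit (pauliOn .Z T) ∉ S}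

/-! ### States and quantum Fisher information -/

open scoped ComplexOrder in
/-- Density matrices. -/
def IsState {Q : Type} [Fintype Q] [DecidableEq Q] (ρ : Op Q) : Prop :=
  ρ.PosSemidef ∧ ρ.trace = 1

/-- Density matrices supported on the code space. -/
def IsCodeState {Q : Type} [Fintype Q] [DecidableEq Q] (S : Subgroup (Op Q)ˣ) (ρ : Op Q) : Prop :=
  IsState ρ ∧ ∀ v : Vec Q, ρ *ᵥ v ∈ codeSpace S

/-- `F` is the quantum Fisher information at the parameter value `ω` of the family of states `ρ`:
`F = tr (ρ Λ²)` for a symmetric logarithmic derivative `Λ`, a Hermitian solution of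
`dρ/dω = (Λ ρ + ρ Λ) / 2`. (The value of `F` does not depend on the choice of `Λ`.) -/
def HasQFI {Q : Type} [Fintype Q] [DecidableEq Q] (ρ : ℝ → Op Q) (ω F : ℝ) : Prop :=
  ∃ D Λ : Op Q, HasDerivAt ρ D ω ∧ Λ.IsHermitian ∧
    (2 : ℂ) • D = Λ * ρ ω + ρ ω * Λ ∧ (F : ℂ) = (ρ ω * (Λ * Λ)).trace

/-! ### The noisy dynamics -/

/-- The `k`-local operators: linear combinations of Pauli strings of weight at most `k`. -/
def kLocal (Q : Type) [Fintype Q] (k : ℕ) : Submodule ℂ (Op Q) :=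
  Submodule.span ℂ {A | ∃ p : Q → Pauli, pauliWeight p ≤ k ∧ A = pauliOp p}

/-- The unknown part of the dynamics: a `2`-local Hamiltonian `H0` and finitely many Lindblad
operators `L a`, each acting nontrivially on only one qubit. -/
structure NoiseModel (Q : Type) [Fintype Q] [DecidableEq Q] where
  H0 : Op Q
  H0_isHermitian : H0.IsHermitian
  H0_mem : H0 ∈ kLocal Q 2
  r : ℕ
  L : Fin r → Op Q
  L_local : ∀ a, ∃ (q : Q) (A : Matrix (Fin 2) (Fin 2) ℂ), L a = singleQubitOp q A

/-- The fully connected three-body interaction `G = ∑_{i<j<k} Z_i Z_j Z_k`. -/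
def zzzInteraction (Q : Type) [Fintype Q] [DecidableEq Q] : Op Q :=
  ∑ T ∈ Finset.powersetCard 3 (Finset.univ : Finset Q), pauliOp (pauliOn .Z T)

/-- The Hamiltonian `H = ω G + H0`. -/
noncomputable def hamiltonian {Q : Type} [Fintype Q] [DecidableEq Q] (N : NoiseModel Q) (ω : ℝ) :
    Op Q :=
  (ω : ℂ) • zzzInteraction Q + N.H0

/-- The right-hand side of the Lindblad master equation,
`-i [H, ρ] + ∑_a (L_a ρ L_a† - {L_a† L_a, ρ} / 2)`. -/
noncomputable def lindbladian {Q : Type} [Fintype Q] [DecidableEq Q] (N : NoiseModel Q) (ω : ℝ)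
    (ρ : Op Q) : Op Q :=
  (-Complex.I) • (hamiltonian N ω * ρ - ρ * hamiltonian N ω) +
    ∑ a, (N.L a * ρ * (N.L a)ᴴ -
      (1 / 2 : ℂ) • ((N.L a)ᴴ * N.L a * ρ + ρ * ((N.L a)ᴴ * N.L a)))

/-- The solution of the master equation that starts in `ρ` is in `ρ'` after time `τ`. -/
def Evolves {Q : Type} [Fintype Q] [DecidableEq Q] (N : NoiseModel Q) (ω τ : ℝ)
    (ρ ρ' : Op Q) : Prop :=
  ∃ y : ℝ → Op Q, (∀ s, HasDerivAt y (lindbladian N ω (y s)) s) ∧ y 0 = ρ ∧ y τ = ρ'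

/-! ### Quantum error correction in the fast control limit -/

/-- The completely positive map `ρ ↦ ∑_i K_i ρ K_i†`. -/
def krausMap {Q : Type} [Fintype Q] [DecidableEq Q] {κ : ℕ} (K : Fin κ → Op Q) (ρ : Op Q) : Op Q :=
  ∑ i, K i * ρ * (K i)ᴴ

/-- A recovery operation of the code for single-qubit errors: a quantum channel, given by Kraus
operators, with outputs in the code space, which undoes (up to normalization) the action of
every operator on a single qubit on every code state. -/
structure Recovery {Q : Type} [Fintype Q] [DecidableEq Q] (S : Subgroup (Op Q)ˣ) where
  κ : ℕ
  K : Fin κ → Op Q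
  tracePreserving : ∑ i, (K i)ᴴ * K i = 1
  range_mem : ∀ i (v : Vec Q), K i *ᵥ v ∈ codeSpace S
  corrects : ∀ (q : Q) (A : Matrix (Fin 2) (Fin 2) ℂ), ∃ c : ℂ, ∀ ρ : Op Q, IsCodeState S ρ →
    krausMap K (singleQubitOp q A * ρ * (singleQubitOp q A)ᴴ) = c • ρ

/-- `ρt` is the state at time `t` when the probes start in `ρ0`, evolve under the noisy dynamics,
and the recovery `R` is applied `M` times, at the times `t / M, 2 t / M, …, t`. -/
def ControlledRun {Q : Type} [Fintype Q] [DecidableEq Q] {S : Subgroup (Op Q)ˣ} (N : NoiseModel Q)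
    (R : Recovery S) (ω t : ℝ) (M : ℕ) (ρ0 ρt : Op Q) : Prop :=
  ∃ σ : ℕ → Op Q, σ 0 = ρ0 ∧ σ M = ρt ∧
    ∀ j < M, ∃ ρ' : Op Q, Evolves N ω (t / M) (σ j) ρ' ∧ σ (j + 1) = krausMap R.K ρ'

/-- `ρt` is the output state at time `t` in the fast control limit, in which the frequency of the
recovery operations tends to infinity. -/
def FastControlOutput {Q : Type} [Fintype Q] [DecidableEq Q] {S : Subgroup (Op Q)ˣ}
    (N : NoiseModel Q) (R : Recovery S) (ω t : ℝ) (ρ0 ρt : Op Q) : Prop :=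
  ∃ out : ℕ → Op Q, (∀ M, 0 < M → ControlledRun N R ω t M ρ0 (out M)) ∧
    Tendsto out atTop (𝓝 ρt)

/-- The values of the quantum Fisher information about `ω` of the output state `ρ_ω(t)` in the
fast control limit that are obtained from the initial states in the code space. -/
def outputQFIs {Q : Type} [Fintype Q] [DecidableEq Q] {S : Subgroup (Op Q)ˣ} (N : NoiseModel Q)
    (R : Recovery S) (ω t : ℝ) : Set ℝ :=
  {F | ∃ ρ0 : Op Q, IsCodeState S ρ0 ∧ ∃ ρ : ℝ → Op Q,
    (∀ ω', FastControlOutput N R ω' t ρ0 (ρ ω')) ∧ HasQFI ρ ω F}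

/-- The output quantum Fisher information about `ω` at time `t`, for the best initial code state. -/
noncomputable def outputQFI {Q : Type} [Fintype Q] [DecidableEq Q] {S : Subgroup (Op Q)ˣ}
    (N : NoiseModel Q) (R : Recovery S) (ω t : ℝ) : ℝ :=
  sSup (outputQFIs N R ω t)

/-! ### The thin surface code -/

/-- The qubits of the thin surface code on the `2 × m` lattice. The lattice has vertices `(r, c)`
with `r ∈ {0, 1, 2}` and `c ∈ {0, …, m - 1}`. The horizontal edges are `inl (r, j)` with
`j ∈ {0, …, m}`, where `inl (r, j)` joins `(r, j - 1)` to `(r, j)`, so that `inl (r, 0)` and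
`inl (r, m)` are the edges that dangle over the left and the right rough boundary. The vertical
edges are `inr (r, c)` with `r ∈ {0, 1}`, where `inr (r, c)` joins `(r, c)` to `(r + 1, c)`. -/
abbrev ThinQubit (m : ℕ) : Type := (Fin 3 × Fin (m + 1)) ⊕ (Fin 2 × Fin m)

/-- The edges around the face between the rows `r` and `r + 1` and the columns `j - 1` and `j`:
two horizontal edges, and those of the vertical edges in these two columns that exist. -/
def plaquette {m : ℕ} (r : Fin 2) (j : Fin (m + 1)) : Finset (ThinQubit m) :=
  (({r.castSucc, r.succ} : Finset (Fin 3)) ×ˢ {j}).disjSum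
    ({r} ×ˢ Finset.univ.filter fun c : Fin m => c.succ = j ∨ c.castSucc = j)

/-- The edges incident to the vertex `(r, c)`, which are the edges crossed by the corresponding
plaquette of the dual lattice. -/
def vertexStar {m : ℕ} (r : Fin 3) (c : Fin m) : Finset (ThinQubit m) :=
  (({r} : Finset (Fin 3)) ×ˢ {c.castSucc, c.succ}).disjSum
    ((Finset.univ.filter fun r' : Fin 2 => r'.castSucc = r ∨ r'.succ = r) ×ˢ {c})

/-- The stabilizer group of the thin surface code, generated by the `X`-type plaquette operators
of the lattice and the `Z`-type plaquette operators of the dual lattice. -/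
def thinSurfaceCode (m : ℕ) : Subgroup (Op (ThinQubit m))ˣ :=
  Subgroup.closure
    ((Set.range fun f : Fin 2 × Fin (m + 1) => pauliUnit (pauliOn .X (plaquette f.1 f.2))) ∪
     (Set.range fun v : Fin 3 × Fin m => pauliUnit (pauliOn .Z (vertexStar v.1 v.2))))

/-! The code is homology of the lattice over `ℤ/2`. A code vector is a function on bit strings that
is supported on cycles (even parity on every vertex star) and invariant under adding plaquettes. By
`cycle_eq_sum` there are two classes of cycles, told apart by the parity on a column, which gives
one encoded qubit. Dually, `Z` on a set `T` commutes with the plaquettes iff `T` is a cocycle; by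
`cocycle_eq_sum` it is then a stabilizer if its row parity is even. If the row parity is odd, `T`
meets all three rows, so with three edges it is a column (`eq_column_of_cocycle`). There are `m + 1
= (n + 2) / 5` columns, and each acts as the encoded `Z`.

Plaquettes separate the qubits, and so do vertex stars when `m ≥ 2`. Hence every nontrivial Pauli
string on at most two qubits anticommutes with a generator and vanishes between code projections:
the distance is 3. With `P` the projection, `G` the three-body interaction and `Z` encoded, `P H0 P`
is a scalar multiple of `P`, and `P G P = a P + (m + 1) Z`
(`codeProj_mul_zzzInteraction_mul_codeProj`).

The Kraus operators of a recovery act on correctable errors of code states as scalars. Trace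
preservation then yields `krausMap_mul_right`: the recovery sends `A ρ` to `P A ρ` for every `A`. It
also forces the jump and decay terms of the noise to cancel, so recovery after Lindbladian is `-i ω
(m + 1) [Z, ρ]` on code states (`krausMap_lindbladian`).

Chernoff's formula turns this into the dynamics of the fast control limit
(`tendsto_interrupted_evolution`): the output is the initial state rotated by `exp (-i ω t (m + 1)
Z)`. The quantum Fisher information is at most four times the second moment of the generator `t (m +
1) Z`, that is `4 t² (m + 1)²` since `Z² = P`. The encoded plus state attains the bound. -/

/-! ### Linear evolution equations and the fast control limit in Banach spaces -/

section BanachAlgebra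

variable {A : Type*} [NormedRing A] [NormOneClass A]

/-- Telescoping. The natural factor is `B ^ (n - 1)`; since `1 ≤ B`, the weaker `B ^ n` avoids the
subtraction. -/
lemma norm_pow_sub_pow_le_mul {a b : A} {B : ℝ} (hB : 1 ≤ B) (ha : ‖a‖ ≤ B) (hb : ‖b‖ ≤ B)
    (n : ℕ) : ‖a ^ n - b ^ n‖ ≤ n * B ^ n * ‖a - b‖ := by
  induction n with
  | zero => simp
  | succ n ih =>
    have h : a ^ (n + 1) - b ^ (n + 1) = (a ^ n - b ^ n) * a + b ^ n * (a - b) := by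
      rw [pow_succ, pow_succ]; noncomm_ring
    have hB0 : 0 ≤ B := zero_le_one.trans hB
    have hn : ‖b ^ n‖ ≤ B ^ (n + 1) :=
      (norm_pow_le b n).trans ((pow_le_pow_left₀ (norm_nonneg _) hb n).trans
        (pow_le_pow_right₀ hB n.le_succ))
    calc ‖a ^ (n + 1) - b ^ (n + 1)‖
        ≤ ‖a ^ n - b ^ n‖ * ‖a‖ + ‖b ^ n‖ * ‖a - b‖ := by
          rw [h]; exact (norm_add_le _ _).trans (add_le_add (norm_mul_le _ _) (norm_mul_le _ _))
      _ ≤ (n * B ^ n * ‖a - b‖) * B + B ^ (n + 1) * ‖a - b‖ := by gcongr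
      _ = ((n + 1 : ℕ) : ℝ) * B ^ (n + 1) * ‖a - b‖ := by push_cast; ring

variable [NormedAlgebra ℝ A]

/-- The stability half of Chernoff's formula: it bounds the `M`-th power of `f (t / M)` by `exp (c
|t|)`, uniformly in large `M`. -/
lemma eventually_norm_le_exp_of_hasDerivAt {f : ℝ → A} {k : A} (hf0 : f 0 = 1)
    (hf : HasDerivAt f k 0) : ∃ c : ℝ, 0 < c ∧ ∀ᶠ s in 𝓝 0, ‖f s‖ ≤ Real.exp (c * |s|) := by
  have hf1 : (fun s : ℝ => f s - 1) =O[𝓝 0] fun s : ℝ => s := by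
    have := hf.isBigO_sub
    simpa [hf0] using this
  obtain ⟨c, hc, hcf⟩ := hf1.exists_pos
  refine ⟨c, hc, hcf.bound.mono fun s hs => ?_⟩
  calc ‖f s‖ = ‖1 + (f s - 1)‖ := by congr 1; abel
    _ ≤ 1 + c * |s| := by
      refine (norm_add_le _ _).trans ?_
      rw [norm_one]; gcongr; exact hs
    _ = c * |s| + 1 := add_comm _ _
    _ ≤ _ := Real.add_one_le_exp _

variable [CompleteSpace A]

/-- Chernoff's product formula in a Banach algebra. -/
theorem tendsto_pow_of_hasDerivAt {f : ℝ → A} {k : A} (hf0 : f 0 = 1) (hf : HasDerivAt f k 0)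
    (t : ℝ) : Tendsto (fun M : ℕ => f (t / M) ^ M) atTop (𝓝 (NormedSpace.exp (t • k))) := by
  have hg : HasDerivAt (fun s : ℝ => NormedSpace.exp (s • k)) k 0 := by
    simpa using hasDerivAt_exp_smul_const (𝕂 := ℝ) k 0
  have hd : (fun s : ℝ => f s - NormedSpace.exp (s • k)) =o[𝓝 0] fun s : ℝ => s := by
    have := (hf.sub hg).isLittleO
    simpa [hf0] using this
  obtain ⟨c, hc, hcf⟩ := eventually_norm_le_exp_of_hasDerivAt hf0 hf
  obtain ⟨c', -, hcg⟩ := eventually_norm_le_exp_of_hasDerivAt (by simp) hg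
  set C := max c c'
  have hC0 : 0 < C := hc.trans_le (le_max_left _ _)
  have ht : Tendsto (fun M : ℕ => t / M) atTop (𝓝 0) := tendsto_const_div_atTop_nhds_zero_nat t
  -- Both `f` and the exponential have derivative `k` at 0, so each of the `M` factors errs by `o(1
  -- / M)`.
  have key : ∀ᶠ M : ℕ in atTop, ‖f (t / M) ^ M - NormedSpace.exp (t • k)‖
      ≤ Real.exp (C * |t|) * (M * ‖f (t / M) - NormedSpace.exp ((t / M) • k)‖) := by
    filter_upwards [ht.eventually hcf, ht.eventually hcg, eventually_gt_atTop 0] with M hM hM' hM0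
    have hM0' : (M : ℝ) ≠ 0 := by positivity
    have h1 : ‖f (t / M)‖ ≤ Real.exp (C * |t / M|) :=
      hM.trans (by gcongr; exact le_max_left _ _)
    have h2 : ‖NormedSpace.exp ((t / M) • k)‖ ≤ Real.exp (C * |t / M|) :=
      hM'.trans (by gcongr; exact le_max_right _ _)
    have h3 := norm_pow_sub_pow_le_mul (Real.one_le_exp (by positivity)) h1 h2 M
    have h4 : NormedSpace.exp ((t / M) • k) ^ M = NormedSpace.exp (t • k) := by
      let _ := NormedAlgebra.restrictScalars ℚ ℝ A
      rw [← NormedSpace.exp_nsmul, ← Nat.cast_smul_eq_nsmul ℝ, smul_smul,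
        mul_div_cancel₀ _ hM0']
    have h5 : Real.exp (C * |t / M|) ^ M = Real.exp (C * |t|) := by
      rw [← Real.exp_nat_mul, abs_div, Nat.abs_cast]
      congr 1; field_simp
    rw [h4, h5] at h3
    linarith
  rw [tendsto_iff_norm_sub_tendsto_zero]
  refine squeeze_zero' (Eventually.of_forall fun _ => norm_nonneg _) key ?_
  rw [← mul_zero (Real.exp (C * |t|))]
  refine Tendsto.const_mul _ ?_
  have h6 : (fun M : ℕ => f (t / M) - NormedSpace.exp ((t / M) • k)) =o[atTop]
      fun M : ℕ => (M : ℝ)⁻¹ := by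
    refine (hd.comp_tendsto ht).trans_isBigO ?_
    refine IsBigO.of_bound |t| (Eventually.of_forall fun M => ?_)
    simp [div_eq_mul_inv]
  have h7 := h6.norm_left.tendsto_div_nhds_zero
  refine h7.congr fun M => ?_
  rw [div_inv_eq_mul, mul_comm]

end BanachAlgebra

section BanachSpace

variable {V : Type*} [NormedAddCommGroup V] [NormedSpace ℝ V] [CompleteSpace V]

lemma hasDerivAt_exp_smul_apply (K : V →L[ℝ] V) (v : V) (s : ℝ) :
    HasDerivAt (fun s : ℝ => NormedSpace.exp (s • K) v) (K (NormedSpace.exp (s • K) v)) s := by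
  have := (hasDerivAt_exp_smul_const' (𝕂 := ℝ) K s).clm_apply (hasDerivAt_const s v)
  simpa using this

lemma eq_exp_smul_apply {K : V →L[ℝ] V} {y : ℝ → V} (hy : ∀ s, HasDerivAt y (K (y s)) s) (t : ℝ) :
    y t = NormedSpace.exp (t • K) (y 0) := by
  have := ODE_solution_unique_univ (v := fun _ => K) (s := fun _ => Set.univ) (t₀ := 0)
    (fun _ => K.lipschitz.lipschitzOnWith) (fun s => ⟨hy s, trivial⟩)
    (fun s => ⟨hasDerivAt_exp_smul_apply K (y 0) s, trivial⟩) (by simp)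
  exact congrFun this t

/-- The fast control limit: interrupting the evolution generated by `L` ever more often by `R`,
which fixes the subspace onto which `P` projects and maps into it, leads to the evolution
generated by `R ∘ L` on this subspace. -/
theorem tendsto_interrupted_evolution {L R P : V →L[ℝ] V} (hPR : P * R = R) (hRP : R * P = P)
    {y : ℝ → V} (hy : ∀ s, HasDerivAt y (R (L (y s))) s) (hP : ∀ s, P (y s) = y s) (t : ℝ) :
    Tendsto (fun M : ℕ => ((R * NormedSpace.exp ((t / M) • L)) ^ M) (y 0)) atTop (𝓝 (y t)) := by
  -- The identity operator has norm 1 only on a nontrivial space.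
  rcases subsingleton_or_nontrivial V with hV | hV
  · exact tendsto_const_nhds.congr fun _ => Subsingleton.elim _ _
  -- `R e^{sL}` need not be the identity at `s = 0`, as Chernoff's formula requires. This `f` is,
  -- and it agrees with `R e^{sL}` on the range of `P`, where `R` is the identity.
  set f : ℝ → V →L[ℝ] V := fun s => 1 + R * (NormedSpace.exp (s • L) - 1) * P with hf
  have hf0 : f 0 = 1 := by simp [hf]
  have hfd : HasDerivAt f (R * L * P) 0 := by
    have h1 : HasDerivAt (fun s : ℝ => NormedSpace.exp (s • L)) L 0 := by
      simpa using hasDerivAt_exp_smul_const (𝕂 := ℝ) L 0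
    exact (((h1.sub_const 1).const_mul R).mul_const P).const_add 1
  have hpow : ∀ (s : ℝ) (j : ℕ), P ((f s ^ j) (y 0)) = (f s ^ j) (y 0) ∧
      (f s ^ j) (y 0) = ((R * NormedSpace.exp (s • L)) ^ j) (y 0) := by
    intro s j
    induction j with
    | zero => simpa using hP 0
    | succ j ih =>
      have hstep : (f s ^ (j + 1)) (y 0) = (R * NormedSpace.exp (s • L)) ((f s ^ j) (y 0)) := by
        have hR : R ((f s ^ j) (y 0)) = (f s ^ j) (y 0) := by
          rw [← ih.1]; exact DFunLike.congr_fun hRP _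
        rw [pow_succ']
        simp only [hf, mul_apply_eq_comp, add_apply, sub_apply, one_apply_eq_self, map_sub]
        rw [ih.1, hR]
        abel
      refine ⟨?_, ?_⟩
      · rw [hstep]; exact DFunLike.congr_fun hPR _
      · rw [hstep, ih.2, pow_succ' (R * NormedSpace.exp (s • L))]; rfl
  have hyt : y t = NormedSpace.exp (t • (R * L * P)) (y 0) :=
    eq_exp_smul_apply (K := R * L * P) (fun s => by
      simpa [hP s] using hy s) t
  rw [hyt]
  have h := tendsto_pow_of_hasDerivAt hf0 hfd t
  refine ((ContinuousLinearMap.apply ℝ V (y 0)).continuous.tendsto _ |>.comp h).congr fun M => ?_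
  exact (hpow _ _).2

/-- The outcomes of an evolution generated by `L` that is interrupted ever more often by `K`. -/
theorem exists_interrupted_run_iff [FiniteDimensional ℝ V] {L K P : V →ₗ[ℝ] V}
    (hPK : ∀ x, P (K x) = K x) (hKP : ∀ x, K (P x) = P x) {y : ℝ → V}
    (hy : ∀ s, HasDerivAt y (K (L (y s))) s) (hP : ∀ s, P (y s) = y s) (t : ℝ) (v : V) :
    (∃ out : ℕ → V, (∀ M : ℕ, 0 < M → ∃ σ : ℕ → V, σ 0 = y 0 ∧ σ M = out M ∧ ∀ j < M, ∃ x : V,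
      (∃ z : ℝ → V, (∀ s, HasDerivAt z (L (z s)) s) ∧ z 0 = σ j ∧ z (t / M) = x) ∧
        σ (j + 1) = K x) ∧ Tendsto out atTop (𝓝 v)) ↔ v = y t := by
  set L' : V →L[ℝ] V := L.toContinuousLinearMap
  set K' : V →L[ℝ] V := K.toContinuousLinearMap
  set P' : V →L[ℝ] V := P.toContinuousLinearMap
  have hevolves : ∀ (τ : ℝ) (a b : V), (∃ z : ℝ → V, (∀ s, HasDerivAt z (L (z s)) s) ∧
      z 0 = a ∧ z τ = b) ↔ b = NormedSpace.exp (τ • L') a := by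
    intro τ a b
    constructor
    · rintro ⟨z, hz, rfl, rfl⟩
      exact eq_exp_smul_apply (K := L') hz τ
    · rintro rfl
      exact ⟨fun s => NormedSpace.exp (s • L') a, fun s => hasDerivAt_exp_smul_apply L' a s,
        by simp, rfl⟩
  simp only [hevolves]
  have hlim : Tendsto (fun M : ℕ => ((K' * NormedSpace.exp ((t / M) • L')) ^ M) (y 0)) atTop
      (𝓝 (y t)) :=
    tendsto_interrupted_evolution (P := P') (ContinuousLinearMap.ext hPK)
      (ContinuousLinearMap.ext hKP) hy hP t
  constructor
  · rintro ⟨out, hout, htend⟩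
    -- Uniqueness for the linear equation determines every run with `0 < M`, hence also the limit.
    refine tendsto_nhds_unique htend (hlim.congr' ?_)
    filter_upwards [eventually_gt_atTop 0] with M hM
    obtain ⟨σ, h0, hσM, hσ⟩ := hout M hM
    have h : ∀ j ≤ M, σ j = ((K' * NormedSpace.exp ((t / M) • L')) ^ j) (y 0) := by
      intro j
      induction j with
      | zero => intro _; rw [h0]; rfl
      | succ j ih =>
        intro hj
        obtain ⟨x, rfl, h2⟩ := hσ j hj
        rw [h2, ih (Nat.le_of_succ_le hj), pow_succ']
        rfl
    rw [← hσM, h M le_rfl]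
  · rintro rfl
    refine ⟨_, fun M _ => ⟨fun j => ((K' * NormedSpace.exp ((t / M) • L')) ^ j) (y 0), rfl, rfl,
      fun j _ => ⟨_, rfl, DFunLike.congr_fun (pow_succ' _ j) (y 0)⟩⟩, hlim⟩

end BanachSpace

/-! ### Pauli strings -/

/-- The sign `(-1) ^ a`. -/
def bitSign (a : Fin 2) : ℂ := if a = 0 then 1 else -1

@[simp] lemma bitSign_zero : bitSign 0 = 1 := rfl

@[simp] lemma bitSign_one : bitSign 1 = -1 := rfl

lemma bitSign_add (a b : Fin 2) : bitSign (a + b) = bitSign a * bitSign b := by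
  fin_cases a <;> fin_cases b <;> simp [bitSign]

lemma bitSign_sum {ι : Type*} (T : Finset ι) (f : ι → Fin 2) :
    bitSign (∑ i ∈ T, f i) = ∏ i ∈ T, bitSign (f i) := by
  classical
  induction T using Finset.induction_on with
  | empty => simp
  | insert a s ha ih => rw [Finset.sum_insert ha, Finset.prod_insert ha, bitSign_add, ih]

lemma bit_add_self (a : Fin 2) : a + a = 0 := by revert a; decide

lemma bit_eq_of_add_eq_zero {a b : Fin 2} (h : a + b = 0) : a = b := by revert a b; decide

lemma bit_ne_zero {a : Fin 2} (h : a ≠ 0) : a = 1 := by revert a; decide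

namespace Pauli

/-- Whether the Pauli operator anticommutes with `X`. -/
def zBit : Pauli → Fin 2
  | .I => 0
  | .X => 0
  | .Y => 1
  | .Z => 1

/-- Whether the Pauli operator anticommutes with `Z`. -/
def xBit : Pauli → Fin 2
  | .I => 0
  | .X => 1
  | .Y => 1
  | .Z => 0

/-- The product of Pauli labels, up to phases. -/
def mulLabel : Pauli → Pauli → Pauli
  | .I, p => p
  | p, .I => p
  | .X, .X => .I
  | .X, .Y => .Z
  | .X, .Z => .Y
  | .Y, .X => .Z
  | .Y, .Y => .I
  | .Y, .Z => .X
  | .Z, .X => .Y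
  | .Z, .Y => .X
  | .Z, .Z => .I

/-- The phase of a product of Pauli matrices. -/
noncomputable def mulPhase : Pauli → Pauli → ℂ
  | .X, .Y => Complex.I
  | .X, .Z => -Complex.I
  | .Y, .X => -Complex.I
  | .Y, .Z => Complex.I
  | .Z, .X => Complex.I
  | .Z, .Y => -Complex.I
  | _, _ => 1

lemma mat_I : Pauli.I.mat = 1 := rfl

lemma mat_mul_mat (p q : Pauli) : p.mat * q.mat = mulPhase p q • (mulLabel p q).mat := by
  cases p <;> cases q <;> ext i j <;> fin_cases i <;> fin_cases j <;>
    simp [mat, mulPhase, mulLabel, Matrix.mul_apply, Fin.sum_univ_two]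

lemma eq_of_mulLabel_eq_I {p q : Pauli} (h : mulLabel p q = .I) : p = q := by
  cases p <;> cases q <;> simp_all [mulLabel]

lemma eq_I_of_bits {p : Pauli} (hx : p.xBit = 0) (hz : p.zBit = 0) : p = .I := by
  cases p <;> simp_all [xBit, zBit]

lemma mat_mul_X (p : Pauli) : p.mat * Pauli.X.mat = bitSign p.zBit • (Pauli.X.mat * p.mat) := by
  cases p <;> ext i j <;> fin_cases i <;> fin_cases j <;>
    simp [mat, zBit, Matrix.mul_apply, Fin.sum_univ_two]

lemma mat_mul_Z (p : Pauli) : p.mat * Pauli.Z.mat = bitSign p.xBit • (Pauli.Z.mat * p.mat) := by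
  cases p <;> ext i j <;> fin_cases i <;> fin_cases j <;>
    simp [mat, xBit, Matrix.mul_apply, Fin.sum_univ_two]

lemma conjTranspose_mat (p : Pauli) : p.matᴴ = p.mat := by
  cases p <;> ext i j <;> fin_cases i <;> fin_cases j <;> simp [mat, Matrix.conjTranspose_apply]

instance : Fintype Pauli where
  elems := {.I, .X, .Y, .Z}
  complete p := by cases p <;> decide

/-- The coefficients of a matrix in the Pauli basis. -/
noncomputable def coeff (A : Matrix (Fin 2) (Fin 2) ℂ) : Pauli → ℂ
  | .I => (A 0 0 + A 1 1) / 2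
  | .X => (A 0 1 + A 1 0) / 2
  | .Y => Complex.I * (A 0 1 - A 1 0) / 2
  | .Z => (A 0 0 - A 1 1) / 2

lemma sum_coeff_smul_mat (A : Matrix (Fin 2) (Fin 2) ℂ) : ∑ p, coeff A p • p.mat = A := by
  have h : (Finset.univ : Finset Pauli) = {.I, .X, .Y, .Z} := rfl
  have hI := Complex.I_mul_I
  ext i j
  rw [h]
  fin_cases i <;> fin_cases j <;> simp [mat, coeff]
  · ring
  · linear_combination ((A 1 0 - A 0 1) / 2) * hI
  · linear_combination ((A 0 1 - A 1 0) / 2) * hI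
  · ring

end Pauli

section Strings

variable {Q : Type} [Fintype Q] [DecidableEq Q]

omit [DecidableEq Q] in
lemma tensorOp_smul (c : Q → ℂ) (A : Q → Matrix (Fin 2) (Fin 2) ℂ) :
    tensorOp (fun q => c q • A q) = (∏ q, c q) • tensorOp A := by
  ext x y
  simp [tensorOp, Finset.prod_mul_distrib]

/-- Each matrix entry contains one factor from the qubit `q`, so it is linear in the local operator.
-/
lemma singleQubitOp_sum {ι : Type*} (s : Finset ι) (q : Q) (c : ι → ℂ)
    (A : ι → Matrix (Fin 2) (Fin 2) ℂ) :
    singleQubitOp q (∑ i ∈ s, c i • A i) = ∑ i ∈ s, c i • singleQubitOp q (A i) := by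
  have h : ∀ (B : Matrix (Fin 2) (Fin 2) ℂ) (x y : Q → Fin 2), singleQubitOp q B x y =
      B (x q) (y q) * ∏ r ∈ Finset.univ.erase q, (1 : Matrix (Fin 2) (Fin 2) ℂ) (x r) (y r) := by
    intro B x y
    simp only [singleQubitOp, tensorOp, Matrix.of_apply]
    rw [← Finset.mul_prod_erase _ _ (Finset.mem_univ q)]
    congr 1
    · simp
    · refine Finset.prod_congr rfl fun r hr => ?_
      rw [Function.update_of_ne (Finset.ne_of_mem_erase hr)]
  ext x y
  rw [h, Matrix.sum_apply, Matrix.sum_apply, Finset.sum_mul]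
  refine Finset.sum_congr rfl fun i _ => ?_
  rw [Matrix.smul_apply, Matrix.smul_apply, h, smul_eq_mul, smul_eq_mul, mul_assoc]

/-- The Pauli string with the label `p` on the qubit `q`. -/
def pauliAt (q : Q) (p : Pauli) : Q → Pauli := Function.update (fun _ => Pauli.I) q p

lemma singleQubitOp_mat (q : Q) (p : Pauli) : singleQubitOp q p.mat = pauliOp (pauliAt q p) := by
  unfold singleQubitOp pauliOp pauliAt
  congr 1
  funext r
  by_cases h : r = q
  · subst h; simp
  · simp [Function.update_of_ne h, Pauli.mat]

lemma singleQubitOp_eq_sum (q : Q) (A : Matrix (Fin 2) (Fin 2) ℂ) :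
    singleQubitOp q A = ∑ p, Pauli.coeff A p • pauliOp (pauliAt q p) := by
  conv_lhs => rw [← Pauli.sum_coeff_smul_mat A]
  rw [singleQubitOp_sum]
  simp only [singleQubitOp_mat]

lemma pauliWeight_pauliAt_le (q : Q) (p : Pauli) : pauliWeight (pauliAt q p) ≤ 1 := by
  refine (Finset.card_le_card (t := {q}) fun r hr => ?_).trans (Finset.card_singleton q).le
  by_contra h
  rw [Finset.mem_singleton] at h
  rw [Finset.mem_filter, pauliAt, Function.update_of_ne h] at hr
  exact hr.2 rfl

lemma pauliOp_I : pauliOp (fun _ : Q => Pauli.I) = 1 := tensorOp_one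

lemma pauliOp_mul_pauliOp (p q : Q → Pauli) : pauliOp p * pauliOp q =
    (∏ r, Pauli.mulPhase (p r) (q r)) • pauliOp fun r => Pauli.mulLabel (p r) (q r) := by
  simp only [pauliOp, tensorOp_mul, Pauli.mat_mul_mat, tensorOp_smul]

lemma pauliOp_mul_self (p : Q → Pauli) : pauliOp p * pauliOp p = 1 := (pauliUnit p).val_inv

omit [DecidableEq Q] in
lemma conjTranspose_pauliOp (p : Q → Pauli) : (pauliOp p)ᴴ = pauliOp p := by
  ext x y
  simp only [pauliOp, tensorOp, Matrix.conjTranspose_apply, Matrix.of_apply, star_prod]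
  refine Finset.prod_congr rfl fun q _ => ?_
  rw [← Matrix.conjTranspose_apply, Pauli.conjTranspose_mat]

omit [DecidableEq Q] in
lemma pauliWeight_mulLabel_le (p q : Q → Pauli) :
    pauliWeight (fun r => Pauli.mulLabel (p r) (q r)) ≤ pauliWeight p + pauliWeight q := by
  classical
  refine (Finset.card_le_card fun r hr => ?_).trans (Finset.card_union_le _ _)
  simp only [Finset.mem_union, Finset.mem_filter, Finset.mem_univ, true_and] at hr ⊢
  by_contra! h
  simp [h.1, h.2, Pauli.mulLabel] at hr

/-- Every qubit of `T` where `p` anticommutes with `X` contributes a sign. Commutation thus becomes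
a parity over `ℤ/2`, which is the link to homology. -/
lemma pauliOp_mul_pauliOn_X (p : Q → Pauli) (T : Finset Q) :
    pauliOp p * pauliOp (pauliOn .X T) =
      bitSign (∑ q ∈ T, (p q).zBit) • (pauliOp (pauliOn .X T) * pauliOp p) := by
  have h : bitSign (∑ q ∈ T, (p q).zBit) = ∏ q, if q ∈ T then bitSign (p q).zBit else 1 := by
    rw [bitSign_sum, Finset.prod_ite_mem, Finset.univ_inter]
  rw [h, pauliOp, pauliOp, tensorOp_mul, tensorOp_mul, ← tensorOp_smul]
  congr 1
  funext q
  unfold pauliOn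
  split_ifs
  · exact Pauli.mat_mul_X _
  · simp [Pauli.mat]

lemma pauliOp_mul_pauliOn_Z (p : Q → Pauli) (T : Finset Q) :
    pauliOp p * pauliOp (pauliOn .Z T) =
      bitSign (∑ q ∈ T, (p q).xBit) • (pauliOp (pauliOn .Z T) * pauliOp p) := by
  have h : bitSign (∑ q ∈ T, (p q).xBit) = ∏ q, if q ∈ T then bitSign (p q).xBit else 1 := by
    rw [bitSign_sum, Finset.prod_ite_mem, Finset.univ_inter]
  rw [h, pauliOp, pauliOp, tensorOp_mul, tensorOp_mul, ← tensorOp_smul]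
  congr 1
  funext q
  unfold pauliOn
  split_ifs
  · exact Pauli.mat_mul_Z _
  · simp [Pauli.mat]

/-- The indicator function of a set of qubits, with values in `ℤ/2`. -/
def bits (T : Finset Q) : Q → Fin 2 := fun q => if q ∈ T then 1 else 0

lemma pauliOn_X_mulVec (T : Finset Q) (ψ : Vec Q) :
    pauliOp (pauliOn .X T) *ᵥ ψ = fun x => ψ (x + bits T) := by
  funext x
  have h : ∀ y, pauliOp (pauliOn .X T) x y = if y = x + bits T then 1 else 0 := by
    intro y
    have h1 : ∀ q, (pauliOn .X T q).mat (x q) (y q) = if y q = x q + bits T q then 1 else 0 := by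
      intro q
      unfold pauliOn bits
      generalize x q = a
      generalize y q = b
      split_ifs with h2 h3 h3 <;> revert h3 <;> fin_cases a <;> fin_cases b <;> simp [Pauli.mat]
    simp only [pauliOp, tensorOp, Matrix.of_apply, h1, Finset.prod_ite_zero,
      Finset.prod_const_one, Finset.mem_univ, true_imp_iff, funext_iff, Pi.add_apply]
  simp [Matrix.mulVec, dotProduct, h]

lemma pauliOn_Z_apply (T : Finset Q) (x y : Q → Fin 2) :
    pauliOp (pauliOn .Z T) x y = if x = y then bitSign (∑ q ∈ T, x q) else 0 := by
  have h1 : ∀ q, (pauliOn .Z T q).mat (x q) (y q) =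
      if x q = y q then (if q ∈ T then bitSign (x q) else 1) else 0 := by
    intro q
    unfold pauliOn
    generalize x q = a
    generalize y q = b
    split_ifs with h2 h3 h3 <;> revert h3 <;> fin_cases a <;> fin_cases b <;> simp [Pauli.mat]
  simp only [pauliOp, tensorOp, Matrix.of_apply, h1, Finset.prod_ite_zero,
      Finset.mem_univ, true_imp_iff, funext_iff, Finset.prod_ite_mem, Finset.univ_inter, bitSign_sum]

lemma pauliOn_Z_mulVec (T : Finset Q) (ψ : Vec Q) :
    pauliOp (pauliOn .Z T) *ᵥ ψ = fun x => bitSign (∑ q ∈ T, x q) * ψ x := by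
  funext x
  simp [Matrix.mulVec, dotProduct, pauliOn_Z_apply]

/-- The Pauli string with `P` on the support of a bit string. -/
def pauliBits (P : Pauli) (a : Q → Fin 2) : Q → Pauli := fun q => if a q = 0 then .I else P

omit [Fintype Q] in
lemma pauliOn_eq_pauliBits (P : Pauli) (T : Finset Q) : pauliOn P T = pauliBits P (bits T) := by
  funext q
  unfold pauliOn pauliBits bits
  split_ifs <;> simp_all

lemma pauliUnit_pauliBits_add (P : Pauli) (a b : Q → Fin 2) :
    pauliUnit (pauliBits P (a + b)) = pauliUnit (pauliBits P a) * pauliUnit (pauliBits P b) := by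
  ext1
  change pauliOp _ = pauliOp _ * pauliOp _
  rw [pauliOp, pauliOp, pauliOp, tensorOp_mul]
  congr 1
  funext q
  unfold pauliBits
  rw [Pi.add_apply]
  generalize a q = c
  generalize b q = d
  fin_cases c <;> fin_cases d <;> simp [Pauli.mat_mul_self, Pauli.mat_I]

lemma pauliUnit_pauliBits_zero (P : Pauli) : pauliUnit (pauliBits P (0 : Q → Fin 2)) = 1 := by
  ext1
  exact pauliOp_I

/-- If the Pauli strings with `P` on each of some sets of qubits belong to a subgroup, so does the
Pauli string with `P` on the symmetric difference of some of these sets. -/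
lemma pauliUnit_pauliBits_sum_mem {ι : Type*} [Fintype ι] {S : Subgroup (Op Q)ˣ} {P : Pauli}
    {T : ι → Finset Q} (hT : ∀ i, pauliUnit (pauliOn P (T i)) ∈ S) (f : ι → Fin 2) :
    pauliUnit (pauliBits P fun q => ∑ i, if q ∈ T i then f i else 0) ∈ S := by
  classical
  have h : ∀ s : Finset ι,
      pauliUnit (pauliBits P fun q => ∑ i ∈ s, if q ∈ T i then f i else 0) ∈ S := by
    intro s
    induction s using Finset.induction_on with
    | empty =>
      simp only [Finset.sum_empty]
      exact (pauliUnit_pauliBits_zero (Q := Q) P) ▸ S.one_mem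
    | insert i s hi ih =>
      have : (fun q => ∑ j ∈ insert i s, if q ∈ T j then f j else 0) =
          (fun q => if q ∈ T i then f i else 0) +
            fun q => ∑ j ∈ s, if q ∈ T j then f j else 0 := by
        funext q
        rw [Finset.sum_insert hi, Pi.add_apply]
      rw [this, pauliUnit_pauliBits_add]
      refine S.mul_mem ?_ ih
      by_cases hf : f i = 0
      · have h0 : (fun q => if q ∈ T i then f i else 0) = (0 : Q → Fin 2) := by
          funext q; simp [hf]
        rw [h0, pauliUnit_pauliBits_zero]
        exact S.one_mem
      · have h1 := hT i
        rw [pauliOn_eq_pauliBits] at h1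
        rw [bit_ne_zero hf]
        exact h1
  exact h Finset.univ

end Strings

/-! ### The lattice of the thin surface code -/

section Lattice

variable {m : ℕ}

/-- The horizontal edges of the last row. -/
def lastRow (m : ℕ) : Finset (ThinQubit m) := (({2} : Finset (Fin 3)) ×ˢ Finset.univ).disjSum ∅

/-- The horizontal edges of a column. -/
def column (j : Fin (m + 1)) : Finset (ThinQubit m) :=
  ((Finset.univ : Finset (Fin 3)) ×ˢ {j}).disjSum ∅

lemma inl_mem_plaquette {r : Fin 2} {j : Fin (m + 1)} {s : Fin 3} {i : Fin (m + 1)} :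
    (Sum.inl (s, i) : ThinQubit m) ∈ plaquette r j ↔ (s = r.castSucc ∨ s = r.succ) ∧ i = j := by
  simp only [plaquette, Finset.inl_mem_disjSum, Finset.mem_product, Finset.mem_insert, Finset.mem_singleton]

lemma inr_mem_plaquette {r : Fin 2} {j : Fin (m + 1)} {s : Fin 2} {c : Fin m} :
    (Sum.inr (s, c) : ThinQubit m) ∈ plaquette r j ↔ s = r ∧ (c.succ = j ∨ c.castSucc = j) := by
  simp only [plaquette, Finset.inr_mem_disjSum, Finset.mem_product, Finset.mem_singleton,
    Finset.mem_filter, Finset.mem_univ, true_and]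

lemma inl_mem_vertexStar {r : Fin 3} {c : Fin m} {s : Fin 3} {i : Fin (m + 1)} :
    (Sum.inl (s, i) : ThinQubit m) ∈ vertexStar r c ↔ s = r ∧ (i = c.castSucc ∨ i = c.succ) := by
  simp only [vertexStar, Finset.inl_mem_disjSum, Finset.mem_product, Finset.mem_insert, Finset.mem_singleton]

lemma inr_mem_vertexStar {r : Fin 3} {c : Fin m} {s : Fin 2} {d : Fin m} :
    (Sum.inr (s, d) : ThinQubit m) ∈ vertexStar r c ↔ (s.castSucc = r ∨ s.succ = r) ∧ d = c := by
  simp only [vertexStar, Finset.inr_mem_disjSum, Finset.mem_product, Finset.mem_singleton,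
    Finset.mem_filter, Finset.mem_univ, true_and]

lemma inl_mem_lastRow {s : Fin 3} {i : Fin (m + 1)} :
    (Sum.inl (s, i) : ThinQubit m) ∈ lastRow m ↔ s = 2 := by
  simp only [lastRow, Finset.inl_mem_disjSum, Finset.mem_product, Finset.mem_singleton,
    Finset.mem_univ, and_true]

lemma inr_notMem_lastRow {s : Fin 2} {c : Fin m} :
    (Sum.inr (s, c) : ThinQubit m) ∉ lastRow m := by
  simp only [lastRow, Finset.inr_mem_disjSum, Finset.notMem_empty, not_false_eq_true]

lemma inl_mem_column {j : Fin (m + 1)} {s : Fin 3} {i : Fin (m + 1)} :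
    (Sum.inl (s, i) : ThinQubit m) ∈ column j ↔ i = j := by
  simp only [column, Finset.inl_mem_disjSum, Finset.mem_product, Finset.mem_singleton,
    Finset.mem_univ, true_and]

lemma inr_notMem_column {j : Fin (m + 1)} {s : Fin 2} {c : Fin m} :
    (Sum.inr (s, c) : ThinQubit m) ∉ column j := by
  simp only [column, Finset.inr_mem_disjSum, Finset.notMem_empty, not_false_eq_true]

lemma castSucc_ne_succ (c : Fin m) : c.castSucc ≠ c.succ := by
  simp [Fin.ext_iff]

/-- The vertical edges appear as indicator sums so that the boundary faces, which lack one of them,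
need no separate treatment. -/
lemma sum_plaquette (x : ThinQubit m → Fin 2) (r : Fin 2) (j : Fin (m + 1)) :
    ∑ q ∈ plaquette r j, x q = x (.inl (r.castSucc, j)) + x (.inl (r.succ, j)) +
      ((∑ c : Fin m, if c.succ = j then x (.inr (r, c)) else 0) +
        ∑ c : Fin m, if c.castSucc = j then x (.inr (r, c)) else 0) := by
  have h1 : r.castSucc ≠ r.succ := castSucc_ne_succ r
  have h2 : Disjoint (Finset.univ.filter fun c : Fin m => c.succ = j)
      (Finset.univ.filter fun c : Fin m => c.castSucc = j) := by
    rw [Finset.disjoint_filter]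
    intro c _ h h'
    exact castSucc_ne_succ c (h'.trans h.symm)
  rw [plaquette, Finset.sum_disjSum, Finset.sum_product, Finset.sum_product, Finset.sum_pair h1,
    Finset.sum_singleton, Finset.sum_singleton, Finset.sum_singleton, Finset.filter_or,
    Finset.sum_union h2, Finset.sum_filter, Finset.sum_filter]

lemma sum_vertexStar (x : ThinQubit m → Fin 2) (r : Fin 3) (c : Fin m) :
    ∑ q ∈ vertexStar r c, x q = x (.inl (r, c.castSucc)) + x (.inl (r, c.succ)) +
      ∑ s : Fin 2, if s.castSucc = r ∨ s.succ = r then x (.inr (s, c)) else 0 := by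
  rw [vertexStar, Finset.sum_disjSum, Finset.sum_product, Finset.sum_product,
    Finset.sum_singleton, Finset.sum_pair (castSucc_ne_succ c), Finset.sum_filter]
  simp only [Finset.sum_singleton]

lemma sum_column (x : ThinQubit m → Fin 2) (j : Fin (m + 1)) :
    ∑ q ∈ column j, x q = x (.inl (0, j)) + x (.inl (1, j)) + x (.inl (2, j)) := by
  rw [column, Finset.sum_disjSum, Finset.sum_product, Finset.sum_empty, Fin.sum_univ_three]
  simp only [Finset.sum_singleton, add_zero]

lemma sum_lastRow (x : ThinQubit m → Fin 2) :
    ∑ q ∈ lastRow m, x q = ∑ j, x (.inl (2, j)) := by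
  rw [lastRow, Finset.sum_disjSum, Finset.sum_product, Finset.sum_empty, Finset.sum_singleton,
    add_zero]

/-! #### Overlaps -/

/-- A star and a face share no edge or two; once the columns are compared, only a finite check on
rows remains. -/
lemma sum_vertexStar_bits_plaquette (s : Fin 3) (c : Fin m) (r : Fin 2) (j : Fin (m + 1)) :
    ∑ q ∈ vertexStar s c, bits (plaquette r j) q = 0 := by
  have h := castSucc_ne_succ c
  simp only [sum_vertexStar, bits, inl_mem_plaquette, inr_mem_plaquette, Fin.sum_univ_two]
  by_cases h1 : c.castSucc = j
  · have h2 : c.succ ≠ j := fun h2 => h (h1.trans h2.symm)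
    simp only [h1, h2]
    revert s r; decide
  · by_cases h2 : c.succ = j
    · simp only [h1, h2]
      revert s r; decide
    · simp [h1, h2]

lemma sum_plaquette_bits_column (r : Fin 2) (j i : Fin (m + 1)) :
    ∑ q ∈ plaquette r j, bits (column i) q = 0 := by
  simp only [sum_plaquette, bits, inl_mem_column, inr_notMem_column, if_false, ite_self,
    Finset.sum_const_zero, add_zero]
  exact bit_add_self _

lemma sum_vertexStar_bits_lastRow (s : Fin 3) (c : Fin m) :
    ∑ q ∈ vertexStar s c, bits (lastRow m) q = 0 := by
  simp only [sum_vertexStar, bits, inl_mem_lastRow, inr_notMem_lastRow, if_false, ite_self,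
    Finset.sum_const_zero, add_zero]
  exact bit_add_self _

lemma sum_column_bits_plaquette (i : Fin (m + 1)) (r : Fin 2) (j : Fin (m + 1)) :
    ∑ q ∈ column i, bits (plaquette r j) q = 0 := by
  simp only [sum_column, bits, inl_mem_plaquette]
  by_cases h : i = j
  · simp only [h]
    revert r; decide
  · simp [h]

/-- The single common edge makes `X` on the row and `Z` on the column anticommute: they are the two
logical operators. -/
lemma sum_column_bits_lastRow (i : Fin (m + 1)) : ∑ q ∈ column i, bits (lastRow m) q = 1 := by
  simp only [sum_column, bits, inl_mem_lastRow]
  decide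

/-! #### Homology -/

/-- The column parity of a cycle does not depend on the column. -/
lemma sum_column_eq_of_cycle {x : ThinQubit m → Fin 2}
    (hx : ∀ s c, ∑ q ∈ vertexStar s c, x q = 0) (i : Fin (m + 1)) :
    ∑ q ∈ column i, x q = ∑ q ∈ column 0, x q := by
  induction i using Fin.induction with
  | zero => rfl
  | succ c ih =>
    rw [← ih, sum_column, sum_column]
    -- In the sum of the three vertex conditions of one lattice column, each vertical edge occurs
    -- twice and cancels.
    have h0 := hx 0 c
    have h1 := hx 1 c
    have h2 := hx 2 c
    simp only [sum_vertexStar, Fin.sum_univ_two] at h0 h1 h2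
    revert h0 h1 h2
    generalize x (.inl (0, c.castSucc)) = a0
    generalize x (.inl (1, c.castSucc)) = a1
    generalize x (.inl (2, c.castSucc)) = a2
    generalize x (.inl (0, c.succ)) = b0
    generalize x (.inl (1, c.succ)) = b1
    generalize x (.inl (2, c.succ)) = b2
    generalize x (.inr (0, c)) = v0
    generalize x (.inr (1, c)) = v1
    revert a0 a1 a2 b0 b1 b2 v0 v1
    decide

/-- Every cycle is a sum of plaquettes and a multiple of the last row. -/
lemma cycle_eq_sum {x : ThinQubit m → Fin 2} (hx : ∀ s c, ∑ q ∈ vertexStar s c, x q = 0) :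
    ∃ g : Fin 2 × Fin (m + 1) → Fin 2, x = (fun q => ∑ f, if q ∈ plaquette f.1 f.2 then g f else 0) +
      if ∑ q ∈ column 0, x q = 0 then 0 else bits (lastRow m) := by
  -- The upper face of a column must produce the edge in row 0, and then the lower face the edge in
  -- row 1. What remains in row 2 is the column parity, the same for all columns.
  refine ⟨fun f => x (.inl (0, f.2)) + if f.1 = 0 then 0 else x (.inl (1, f.2)), ?_⟩
  funext q
  rw [Pi.add_apply, Fintype.sum_prod_type, Fin.sum_univ_two]
  rcases q with ⟨s, i⟩ | ⟨s, c⟩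
  · have hc := sum_column_eq_of_cycle hx i
    rw [← hc, sum_column]
    simp only [inl_mem_plaquette, ite_and, Finset.sum_ite_irrel, Finset.sum_ite_eq, Finset.mem_univ,
      if_true, Finset.sum_const_zero, apply_ite (fun F : ThinQubit m → Fin 2 => F (Sum.inl (s, i))),
      bits, inl_mem_lastRow, Pi.zero_apply]
    obtain rfl | rfl | rfl : s = 0 ∨ s = 1 ∨ s = 2 := by revert s; decide
    all_goals
      generalize x (.inl (0, i)) = a0
      generalize x (.inl (1, i)) = a1
      generalize x (.inl (2, i)) = a2
      revert a0 a1 a2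
      decide
  · have h0 := hx 0 c
    have h1 := hx 1 c
    have hne := castSucc_ne_succ c
    have hsum : ∀ F : Fin (m + 1) → Fin 2,
        ∑ j, (if c.succ = j ∨ c.castSucc = j then F j else 0) = F c.succ + F c.castSucc := by
      intro F
      rw [← Finset.sum_filter, Finset.filter_or, Finset.sum_union, Finset.filter_eq,
        Finset.filter_eq]
      · simp
      · rw [Finset.disjoint_filter]
        intro j _ h h'
        exact hne (h'.trans h.symm)
    simp only [inr_mem_plaquette, ite_and, Finset.sum_ite_irrel, hsum, Finset.sum_const_zero,
      apply_ite (fun F : ThinQubit m → Fin 2 => F (Sum.inr (s, c))),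
      bits, inr_notMem_lastRow, Pi.zero_apply, if_false, ite_self]
    simp only [sum_vertexStar, Fin.sum_univ_two] at h0 h1
    revert h0 h1
    obtain rfl | rfl : s = 0 ∨ s = 1 := by revert s; decide
    all_goals
      generalize x (.inl (0, c.castSucc)) = a0
      generalize x (.inl (1, c.castSucc)) = a1
      generalize x (.inl (0, c.succ)) = b0
      generalize x (.inl (1, c.succ)) = b1
      generalize x (.inr (0, c)) = v0
      generalize x (.inr (1, c)) = v1
      revert a0 a1 b0 b1 v0 v1
      decide

end Lattice

section Lattice

variable {m : ℕ}

/-! #### Cohomology -/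

lemma sum_Iic_fin_zero (f : Fin (m + 1) → Fin 2) : ∑ i ∈ Finset.Iic 0, f i = f 0 := by
  have : (Finset.Iic 0 : Finset (Fin (m + 1))) = {0} := by ext; simp
  rw [this, Finset.sum_singleton]

lemma sum_Iic_fin_succ (f : Fin (m + 1) → Fin 2) (c : Fin m) :
    ∑ i ∈ Finset.Iic c.succ, f i = ∑ i ∈ Finset.Iic c.castSucc, f i + f c.succ := by
  have : Finset.Iic c.succ = insert c.succ (Finset.Iic c.castSucc) := by
    ext i
    simp only [Finset.mem_Iic, Finset.mem_insert, Fin.le_def, Fin.ext_iff, Fin.val_succ,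
      Fin.val_castSucc]
    omega
  rw [this, Finset.sum_insert (by simp [Fin.le_def]), add_comm]

lemma sum_Iic_fin_last (f : Fin (m + 1) → Fin 2) :
    ∑ i ∈ Finset.Iic (Fin.last m), f i = ∑ i, f i := by
  congr 1
  ext i
  simp [Fin.le_last]

/-- For a cocycle, the parity of the edges to the left of a point of two consecutive rows differs
by the vertical edge at this point. -/
lemma sum_Iic_add_sum_Iic_of_cocycle {t : ThinQubit m → Fin 2}
    (ht : ∀ r j, ∑ q ∈ plaquette r j, t q = 0) (r : Fin 2) (j : Fin (m + 1)) :
    ∑ i ∈ Finset.Iic j, t (.inl (r.castSucc, i)) + ∑ i ∈ Finset.Iic j, t (.inl (r.succ, i)) =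
      ∑ c : Fin m, if c.castSucc = j then t (.inr (r, c)) else 0 := by
  induction j using Fin.induction with
  | zero =>
    have h := ht r 0
    rw [sum_plaquette] at h
    simp only [Fin.succ_ne_zero, if_false, Finset.sum_const_zero, zero_add] at h
    rw [sum_Iic_fin_zero, sum_Iic_fin_zero]
    exact bit_eq_of_add_eq_zero h
  | succ c ih =>
    have h := ht r c.succ
    simp only [sum_plaquette, Fin.succ_inj, Finset.sum_ite_eq', Finset.mem_univ, if_true] at h
    simp only [Fin.castSucc_inj, Finset.sum_ite_eq', Finset.mem_univ, if_true] at ih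
    rw [sum_Iic_fin_succ, sum_Iic_fin_succ]
    revert h ih
    generalize ∑ i ∈ Finset.Iic c.castSucc, t (.inl (r.castSucc, i)) = a
    generalize ∑ i ∈ Finset.Iic c.castSucc, t (.inl (r.succ, i)) = b
    generalize t (.inl (r.castSucc, c.succ)) = a'
    generalize t (.inl (r.succ, c.succ)) = b'
    generalize t (.inr (r, c)) = v
    generalize (∑ d : Fin m, if d.castSucc = c.succ then t (.inr (r, d)) else 0) = w
    revert a b a' b' v w
    decide

/-- The row parity of a cocycle does not depend on the row. -/
lemma sum_row_eq_of_cocycle {t : ThinQubit m → Fin 2}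
    (ht : ∀ r j, ∑ q ∈ plaquette r j, t q = 0) (s : Fin 3) :
    ∑ j, t (.inl (s, j)) = ∑ q ∈ lastRow m, t q := by
  have h : ∀ r : Fin 2, ∑ j, t (.inl (r.castSucc, j)) = ∑ j, t (.inl (r.succ, j)) := by
    intro r
    -- No vertical edge lies at the right end, so the difference of the two full row parities is an
    -- empty sum.
    have h := sum_Iic_add_sum_Iic_of_cocycle ht r (Fin.last m)
    simp only [Fin.castSucc_ne_last, if_false, Finset.sum_const_zero, sum_Iic_fin_last] at h
    exact bit_eq_of_add_eq_zero h
  rw [sum_lastRow]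
  obtain rfl | rfl | rfl : s = 0 ∨ s = 1 ∨ s = 2 := by revert s; decide
  · exact (h 0).trans (h 1)
  · exact h 1
  · rfl

/-- Every cocycle of even row parity is a sum of vertex stars. -/
lemma cocycle_eq_sum {t : ThinQubit m → Fin 2} (ht : ∀ r j, ∑ q ∈ plaquette r j, t q = 0)
    (h0 : ∑ q ∈ lastRow m, t q = 0) :
    ∃ f : Fin 3 × Fin m → Fin 2, t = fun q => ∑ v, if q ∈ vertexStar v.1 v.2 then f v else 0 := by
  set p : Fin 3 → Fin (m + 1) → Fin 2 := fun s j => ∑ i ∈ Finset.Iic j, t (.inl (s, i)) with hp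
  -- The coefficient of a vertex is the parity of the row to its left. A horizontal edge is then a
  -- difference of consecutive partial sums; at the right boundary, with no vertex beyond, this
  -- needs even row parity.
  refine ⟨fun v => p v.1 v.2.castSucc, ?_⟩
  funext q
  rw [Fintype.sum_prod_type]
  rcases q with ⟨s, j⟩ | ⟨s, c⟩
  · simp only [inl_mem_vertexStar, ite_and, Finset.sum_ite_irrel, Finset.sum_const_zero,
      Finset.sum_ite_eq, Finset.mem_univ, if_true]
    have hsplit : ∀ c : Fin m, (if j = c.castSucc ∨ j = c.succ then p s c.castSucc else 0) =
        (if c.castSucc = j then p s j else 0) + if c.succ = j then p s c.castSucc else 0 := by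
      intro c
      by_cases h1 : j = c.castSucc
      · have h2 : c.succ ≠ j := fun h2 => castSucc_ne_succ c (h1.symm.trans h2.symm)
        rw [if_neg h2, if_pos h1.symm, if_pos (Or.inl h1), h1, add_zero]
      · simp [h1, eq_comm]
    have hright : (∑ c : Fin m, if c.castSucc = j then p s j else 0) = p s j := by
      induction j using Fin.lastCases with
      | last =>
        have : p s (Fin.last m) = 0 := by
          rw [hp]
          simp only
          rw [sum_Iic_fin_last, sum_row_eq_of_cocycle ht, h0]
        simp [this]
      | cast c => simp
    rw [Finset.sum_congr rfl fun c _ => hsplit c, Finset.sum_add_distrib, hright]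
    induction j using Fin.cases with
    | zero =>
      simp only [Fin.succ_ne_zero, if_false, Finset.sum_const_zero, add_zero, hp]
      exact (sum_Iic_fin_zero fun i => t (.inl (s, i))).symm
    | succ c =>
      simp only [Fin.succ_inj, Finset.sum_ite_eq', Finset.mem_univ, if_true, hp, sum_Iic_fin_succ]
      generalize ∑ i ∈ Finset.Iic c.castSucc, t (.inl (s, i)) = a
      generalize t (.inl (s, c.succ)) = b
      revert a b
      decide
  · have h := sum_Iic_add_sum_Iic_of_cocycle ht s c.castSucc
    simp only [Fin.castSucc_inj, Finset.sum_ite_eq', Finset.mem_univ, if_true] at h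
    rw [← h]
    simp only [inr_mem_vertexStar, ite_and, Finset.sum_ite_irrel, Finset.sum_const_zero,
      Finset.sum_ite_eq, Finset.mem_univ, if_true]
    rw [← Finset.sum_filter, Finset.filter_or, Finset.sum_union, Finset.filter_eq,
      Finset.filter_eq]
    · simp [hp]
    · rw [Finset.disjoint_filter]
      intro j _ h h'
      exact castSucc_ne_succ s (h.trans h'.symm)

/-- The sets of three edges that represent the nontrivial cohomology class are the columns. -/
lemma eq_column_of_cocycle {T : Finset (ThinQubit m)} (hT : T.card = 3)
    (ht : ∀ r j, ∑ q ∈ plaquette r j, bits T q = 0) (h1 : ∑ q ∈ lastRow m, bits T q ≠ 0) :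
    ∃ j, T = column j := by
  -- All rows have the same odd parity, so none is missed; three edges leave exactly one per row and
  -- no vertical edge.
  have hrow : ∀ s : Fin 3, ∃ j, (Sum.inl (s, j) : ThinQubit m) ∈ T := by
    intro s
    by_contra! h
    rw [← sum_row_eq_of_cocycle ht s] at h1
    exact h1 (Finset.sum_eq_zero fun j _ => if_neg (h j))
  choose j hj using hrow
  have hinj : Function.Injective fun s : Fin 3 => (Sum.inl (s, j s) : ThinQubit m) := by
    intro s s' h
    simp only [Sum.inl.injEq, Prod.mk.injEq] at h
    exact h.1
  have hTeq : T = Finset.univ.image fun s : Fin 3 => (Sum.inl (s, j s) : ThinQubit m) := by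
    symm
    refine Finset.eq_of_subset_of_card_le (fun q hq => ?_) ?_
    · obtain ⟨s, -, rfl⟩ := Finset.mem_image.mp hq
      exact hj s
    · rw [Finset.card_image_of_injective _ hinj, hT]
      rfl
  have hl : ∀ s i, (Sum.inl (s, i) : ThinQubit m) ∈ T ↔ i = j s := by
    intro s i
    rw [hTeq]
    simp [eq_comm]
  have hr : ∀ s c, (Sum.inr (s, c) : ThinQubit m) ∉ T := by
    intro s c
    rw [hTeq]
    simp
  -- If the edges of adjacent rows were not aligned, the face below or above one of them would meet
  -- `T` only once.
  have hstep : ∀ r : Fin 2, j r.castSucc = j r.succ := by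
    intro r
    have h := ht r (j r.castSucc)
    simp only [sum_plaquette, bits, hl, hr, if_false, ite_self, Finset.sum_const_zero, add_zero,
      if_true] at h
    by_contra hne
    rw [if_neg hne] at h
    exact absurd h (by decide)
  have h01 : j 0 = j 1 := hstep 0
  have h12 : j 1 = j 2 := hstep 1
  refine ⟨j 0, ?_⟩
  ext q
  rcases q with ⟨s, i⟩ | ⟨s, c⟩
  · rw [hl, inl_mem_column]
    obtain rfl | rfl | rfl : s = 0 ∨ s = 1 ∨ s = 2 := by revert s; decide
    · rfl
    · rw [h01]
    · rw [h01, h12]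
  · exact iff_of_false (hr s c) inr_notMem_column

lemma card_column (j : Fin (m + 1)) : (column j).card = 3 := by
  simp [column]

lemma column_injective : Function.Injective (column : Fin (m + 1) → Finset (ThinQubit m)) := by
  intro i j h
  have := (inl_mem_column (s := 0) (i := i) (j := i)).mpr rfl
  rw [h, inl_mem_column] at this
  exact this

/-! #### Detection of errors on two qubits -/

/-- If a family of sets separates points and covers, then a nonempty set of at most two points has
odd intersection with one of them. -/
lemma eq_zero_of_separating {Q ι : Type*} [Fintype Q] [DecidableEq Q] {T : ι → Finset Q}
    (hcov : ∀ q, ∃ i, q ∈ T i) (hsep : ∀ q q', (∀ i, q ∈ T i ↔ q' ∈ T i) → q = q')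
    {a : Q → Fin 2} (ha : (Finset.univ.filter fun q => a q ≠ 0).card ≤ 2)
    (h : ∀ i, ∑ q ∈ T i, a q = 0) : a = 0 := by
  have hsum : ∀ i, ∑ q ∈ T i, a q =
      ∑ q ∈ Finset.univ.filter fun q => a q ≠ 0, if q ∈ T i then (1 : Fin 2) else 0 := by
    intro i
    rw [Finset.sum_filter, ← Finset.univ_inter (T i), ← Finset.sum_ite_mem]
    refine Finset.sum_congr rfl fun q _ => ?_
    by_cases hq : a q = 0
    · simp [hq]
    · simp [bit_ne_zero hq]
  simp only [hsum] at h
  set U := Finset.univ.filter fun q => a q ≠ 0 with hU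
  have hU0 : U = ∅ := by
    rcases Nat.lt_or_ge U.card 1 with h0 | h1
    · exact Finset.card_eq_zero.mp (by omega)
    rcases Nat.lt_or_ge U.card 2 with h1' | h2
    · obtain ⟨q, hq⟩ := Finset.card_eq_one.mp (by omega : U.card = 1)
      obtain ⟨i, hi⟩ := hcov q
      have := h i
      rw [hq, Finset.sum_singleton, if_pos hi] at this
      exact absurd this (by decide)
    · obtain ⟨q, q', hne, hq⟩ := Finset.card_eq_two.mp (by omega : U.card = 2)
      refine absurd (hsep q q' fun i => ?_) hne
      have := h i
      rw [hq, Finset.sum_pair hne] at this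
      by_cases h1 : q ∈ T i <;> by_cases h2 : q' ∈ T i <;> simp_all
  funext q
  by_contra hq
  have : q ∈ U := by simpa [hU] using hq
  simp [hU0] at this

lemma exists_mem_plaquette (q : ThinQubit m) :
    ∃ f : Fin 2 × Fin (m + 1), q ∈ plaquette f.1 f.2 := by
  rcases q with ⟨s, i⟩ | ⟨s, c⟩
  · obtain rfl | rfl | rfl : s = 0 ∨ s = 1 ∨ s = 2 := by revert s; decide
    · exact ⟨(0, i), inl_mem_plaquette.mpr (by simp)⟩
    · exact ⟨(0, i), inl_mem_plaquette.mpr (by simp)⟩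
    · exact ⟨(1, i), inl_mem_plaquette.mpr (by simp)⟩
  · exact ⟨(s, c.succ), inr_mem_plaquette.mpr (by simp)⟩

/-- A horizontal edge lies only in faces of one column, a vertical edge in faces of two columns;
this tells the two kinds apart. -/
lemma eq_of_mem_plaquette_iff {q q' : ThinQubit m}
    (h : ∀ f : Fin 2 × Fin (m + 1), q ∈ plaquette f.1 f.2 ↔ q' ∈ plaquette f.1 f.2) : q = q' := by
  have hmix : ∀ (s : Fin 3) (i : Fin (m + 1)) (r : Fin 2) (c : Fin m),
      ¬ ∀ f : Fin 2 × Fin (m + 1), (Sum.inl (s, i) : ThinQubit m) ∈ plaquette f.1 f.2 ↔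
        (Sum.inr (r, c) : ThinQubit m) ∈ plaquette f.1 f.2 := by
    intro s i r c h
    have h1 := h (r, c.succ)
    have h2 := h (r, c.castSucc)
    simp only [inl_mem_plaquette, inr_mem_plaquette, true_or, or_true, true_and, iff_true] at h1 h2
    exact castSucc_ne_succ c (h2.2.symm.trans h1.2)
  rcases q with ⟨s, i⟩ | ⟨s, c⟩ <;> rcases q' with ⟨s', i'⟩ | ⟨s', c'⟩
  · have h0 := fun j => h (0, j)
    have h1 := fun j => h (1, j)
    simp only [inl_mem_plaquette] at h0 h1
    have hi : i = i' := by
      by_contra hne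
      replace h0 := h0 i
      replace h1 := h1 i
      simp only [and_true, Ne.symm hne, and_false, iff_false] at h0 h1
      revert h0 h1
      clear h
      revert s; decide
    subst hi
    replace h0 := h0 i
    replace h1 := h1 i
    simp only [and_true] at h0 h1
    congr 2
    revert h0 h1
    clear h
    revert s s'
    decide
  · exact absurd h (hmix s i s' c')
  · exact absurd (fun f => (h f).symm) (hmix s' i' s c)
  · have h1 := h (s, c.succ)
    have h2 := h (s, c.castSucc)
    simp only [inr_mem_plaquette, true_or, or_true, and_true, true_iff,
      Fin.ext_iff, Fin.val_succ, Fin.val_castSucc] at h1 h2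
    have h3 : s = s' := Fin.ext (by omega)
    have h4 : c = c' := Fin.ext (by omega)
    rw [h3, h4]

lemma exists_mem_vertexStar (hm : 2 ≤ m) (q : ThinQubit m) :
    ∃ v : Fin 3 × Fin m, q ∈ vertexStar v.1 v.2 := by
  rcases q with ⟨s, i⟩ | ⟨s, c⟩
  · induction i using Fin.cases with
    | zero => exact ⟨(s, ⟨0, by omega⟩), inl_mem_vertexStar.mpr ⟨rfl, Or.inl rfl⟩⟩
    | succ c => exact ⟨(s, c), inl_mem_vertexStar.mpr ⟨rfl, Or.inr rfl⟩⟩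
  · exact ⟨(s.castSucc, c), inr_mem_vertexStar.mpr ⟨Or.inl rfl, rfl⟩⟩

/-- Here `2 ≤ m` is essential: for `m = 1` the two dangling edges of a row end at the same vertex,
and `Z` on both could not be told from the identity by the vertices these edges meet. -/
lemma eq_of_mem_vertexStar_iff (hm : 2 ≤ m) {q q' : ThinQubit m}
    (h : ∀ v : Fin 3 × Fin m, q ∈ vertexStar v.1 v.2 ↔ q' ∈ vertexStar v.1 v.2) : q = q' := by
  have hmix : ∀ (s : Fin 3) (i : Fin (m + 1)) (r : Fin 2) (c : Fin m),
      ¬ ∀ v : Fin 3 × Fin m, (Sum.inl (s, i) : ThinQubit m) ∈ vertexStar v.1 v.2 ↔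
        (Sum.inr (r, c) : ThinQubit m) ∈ vertexStar v.1 v.2 := by
    intro s i r c h
    have h1 := h (r.succ, c)
    have h2 := h (r.castSucc, c)
    simp only [inl_mem_vertexStar, inr_mem_vertexStar, true_or, or_true, true_and, iff_true]
      at h1 h2
    exact castSucc_ne_succ r (h2.1.symm.trans h1.1)
  rcases q with ⟨s, i⟩ | ⟨s, c⟩ <;> rcases q' with ⟨s', i'⟩ | ⟨s', c'⟩
  · have hs : s = s' := by
      obtain ⟨⟨r, c⟩, hv⟩ := exists_mem_vertexStar hm (Sum.inl (s, i))
      have hv' := (h (r, c)).mp hv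
      exact (inl_mem_vertexStar.mp hv).1.trans (inl_mem_vertexStar.mp hv').1.symm
    subst hs
    have hi : ∀ k, k < m → ((i : ℕ) = k ∨ (i : ℕ) = k + 1 ↔ (i' : ℕ) = k ∨ (i' : ℕ) = k + 1) := by
      intro k hk
      have h1 := h (s, ⟨k, hk⟩)
      simpa only [inl_mem_vertexStar, true_and, Fin.ext_iff, Fin.val_castSucc, Fin.val_succ]
        using h1
    have h1 := hi i
    have h2 := hi (i - 1)
    have h3 := hi i'
    have h4 := hi (i' - 1)
    have : i = i' := Fin.ext (by omega)
    rw [this]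
  · exact absurd h (hmix s i s' c')
  · exact absurd (fun f => (h f).symm) (hmix s' i' s c)
  · have h1 := h (s.succ, c)
    have h2 := h (s.castSucc, c)
    simp only [inr_mem_vertexStar, true_or, or_true, true_and, true_iff] at h1 h2
    rw [h1.2]
    replace h1 := h1.1
    replace h2 := h2.1
    have : s = s' := by
      revert h1 h2
      clear h
      revert s s'
      decide
    rw [this]

/-- A Pauli string on at most two qubits that commutes with all generators of the thin surface
code is trivial. -/
lemma eq_I_of_commutes (hm : 2 ≤ m) {p : ThinQubit m → Pauli} (hp : pauliWeight p ≤ 2)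
    (hX : ∀ r j, ∑ q ∈ plaquette r j, (p q).zBit = 0)
    (hZ : ∀ s c, ∑ q ∈ vertexStar s c, (p q).xBit = 0) : p = fun _ => Pauli.I := by
  have hz : (fun q => (p q).zBit) = 0 := by
    refine eq_zero_of_separating exists_mem_plaquette (fun _ _ => eq_of_mem_plaquette_iff)
      ((Finset.card_le_card fun q hq => ?_).trans hp) fun f => hX f.1 f.2
    simp only [Finset.mem_filter, Finset.mem_univ, true_and] at hq ⊢
    rintro h
    exact hq (by rw [h]; rfl)
  have hx : (fun q => (p q).xBit) = 0 := by
    refine eq_zero_of_separating (exists_mem_vertexStar hm) (fun _ _ => eq_of_mem_vertexStar_iff hm)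
      ((Finset.card_le_card fun q hq => ?_).trans hp) fun v => hZ v.1 v.2
    simp only [Finset.mem_filter, Finset.mem_univ, true_and] at hq ⊢
    rintro h
    exact hq (by rw [h]; rfl)
  funext q
  exact Pauli.eq_I_of_bits (congrFun hx q) (congrFun hz q)

end Lattice

/-! ### Encoded qubits -/

section EncodedQubit

variable {Q : Type}

/-- The operator that is diagonal in the basis `e` of the encoded qubit. -/
def encodedDiag (e : Fin 2 → Vec Q) (d : Fin 2 → ℂ) : Op Q :=
  ∑ b, d b • Matrix.vecMulVec (e b) (star (e b))

/-- The projection onto the code space. -/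
def codeProj (e : Fin 2 → Vec Q) : Op Q := encodedDiag e 1

/-- The encoded Pauli operator `Z`. -/
def encodedZ (e : Fin 2 → Vec Q) : Op Q := encodedDiag e bitSign

lemma conjTranspose_encodedDiag (e : Fin 2 → Vec Q) {d : Fin 2 → ℂ} (hd : ∀ b, star (d b) = d b) :
    (encodedDiag e d)ᴴ = encodedDiag e d := by
  rw [encodedDiag, Matrix.conjTranspose_sum]
  refine Finset.sum_congr rfl fun b _ => ?_
  rw [Matrix.conjTranspose_smul, hd, Matrix.conjTranspose_vecMulVec, star_star]

lemma conjTranspose_codeProj (e : Fin 2 → Vec Q) : (codeProj e)ᴴ = codeProj e :=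
  conjTranspose_encodedDiag e fun _ => star_one ℂ

lemma conjTranspose_encodedZ (e : Fin 2 → Vec Q) : (encodedZ e)ᴴ = encodedZ e :=
  conjTranspose_encodedDiag e fun b => by fin_cases b <;> simp

lemma encodedDiag_mulVec [Fintype Q] [DecidableEq Q] (e : Fin 2 → Vec Q) (d : Fin 2 → ℂ) (v : Vec Q) :
    encodedDiag e d *ᵥ v = ∑ b, (d b * (star (e b) ⬝ᵥ v)) • e b := by
  rw [encodedDiag, Matrix.sum_mulVec]
  refine Finset.sum_congr rfl fun b _ => ?_
  rw [Matrix.smul_mulVec, Matrix.vecMulVec_mulVec, op_smul_eq_smul, smul_smul]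

variable [Fintype Q] [DecidableEq Q] {S : Subgroup (Op Q)ˣ}

/-- An orthonormal basis of the space of an encoded qubit. -/
structure IsCodeBasis (S : Subgroup (Op Q)ˣ) (e : Fin 2 → Vec Q) : Prop where
  mem : ∀ b, e b ∈ codeSpace S
  orthonormal : ∀ a b, star (e a) ⬝ᵥ e b = if a = b then 1 else 0
  span : ∀ ψ ∈ codeSpace S, ∃ c : Fin 2 → ℂ, ψ = ∑ b, c b • e b

/-- The encoded state `|+⟩`. -/
noncomputable def plusState (e : Fin 2 → Vec Q) : Vec Q := (Real.sqrt 2 : ℂ)⁻¹ • (e 0 + e 1)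

lemma inv_sqrt_two_mul_self : (Real.sqrt 2 : ℂ)⁻¹ * (Real.sqrt 2 : ℂ)⁻¹ = 1 / 2 := by
  rw [← mul_inv, ← Complex.ofReal_mul, Real.mul_self_sqrt (by norm_num)]
  norm_num

namespace IsCodeBasis

variable {e : Fin 2 → Vec Q} (he : IsCodeBasis S e)
include he

lemma encodedDiag_mul_encodedDiag (d d' : Fin 2 → ℂ) :
    encodedDiag e d * encodedDiag e d' = encodedDiag e (d * d') := by
  simp only [encodedDiag, Finset.sum_mul, Finset.mul_sum, Matrix.smul_mul, Matrix.mul_smul,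
    Matrix.vecMulVec_mul_vecMulVec, he.orthonormal]
  simp [Fin.sum_univ_two, smul_smul, mul_comm]

lemma codeProj_mul_codeProj : codeProj e * codeProj e = codeProj e := by
  rw [codeProj, he.encodedDiag_mul_encodedDiag, one_mul]

lemma codeProj_mul_encodedZ : codeProj e * encodedZ e = encodedZ e := by
  rw [codeProj, encodedZ, he.encodedDiag_mul_encodedDiag, one_mul]

lemma encodedZ_mul_codeProj : encodedZ e * codeProj e = encodedZ e := by
  rw [codeProj, encodedZ, he.encodedDiag_mul_encodedDiag, mul_one]

lemma encodedZ_mul_encodedZ : encodedZ e * encodedZ e = codeProj e := by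
  rw [codeProj, encodedZ, he.encodedDiag_mul_encodedDiag]
  congr 1
  funext b
  fin_cases b <;> simp

lemma encodedDiag_mulVec_mem (d : Fin 2 → ℂ) (v : Vec Q) : encodedDiag e d *ᵥ v ∈ codeSpace S := by
  rw [encodedDiag_mulVec]
  exact Submodule.sum_mem _ fun b _ => Submodule.smul_mem _ _ (he.mem b)

lemma codeProj_mulVec_mem (v : Vec Q) : codeProj e *ᵥ v ∈ codeSpace S :=
  he.encodedDiag_mulVec_mem 1 v

lemma encodedDiag_mulVec_basis (d : Fin 2 → ℂ) (b : Fin 2) :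
    encodedDiag e d *ᵥ e b = d b • e b := by
  rw [encodedDiag_mulVec]
  simp [he.orthonormal]

lemma codeProj_mulVec {ψ : Vec Q} (hψ : ψ ∈ codeSpace S) : codeProj e *ᵥ ψ = ψ := by
  obtain ⟨c, rfl⟩ := he.span ψ hψ
  rw [Matrix.mulVec_sum]
  refine Finset.sum_congr rfl fun b _ => ?_
  rw [Matrix.mulVec_smul, codeProj, he.encodedDiag_mulVec_basis, Pi.one_apply, one_smul]

lemma codeProj_mul {A : Op Q} (hA : ∀ v, A *ᵥ v ∈ codeSpace S) : codeProj e * A = A := by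
  refine Matrix.ext_of_mulVec_single fun x => ?_
  rw [← Matrix.mulVec_mulVec, he.codeProj_mulVec (hA _)]

omit he in
lemma mul_codeProj_eq_of_basis {A B : Op Q} (h : ∀ b, A *ᵥ e b = B *ᵥ e b) :
    A * codeProj e = B * codeProj e := by
  simp only [codeProj, encodedDiag, Finset.mul_sum, Matrix.mul_smul, Matrix.mul_vecMulVec, h]

lemma mul_codeProj_of_mem {s : (Op Q)ˣ} (hs : s ∈ S) : (s : Op Q) * codeProj e = codeProj e := by
  have := mul_codeProj_eq_of_basis (e := e) (A := s) (B := 1) fun b => by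
    rw [he.mem b s hs, Matrix.one_mulVec]
  rwa [one_mul] at this

lemma codeProj_mul_pauliOp {g : Q → Pauli} (hg : pauliUnit g ∈ S) :
    codeProj e * pauliOp g = codeProj e := by
  have h : pauliOp g * codeProj e = codeProj e := he.mul_codeProj_of_mem hg
  have h1 := congrArg Matrix.conjTranspose h
  rwa [Matrix.conjTranspose_mul, conjTranspose_codeProj, conjTranspose_pauliOp] at h1

/-- Pauli strings that anticommute with a stabilizer are detected. -/
lemma codeProj_mul_mul_codeProj_eq_zero {p g : Q → Pauli} (hg : pauliUnit g ∈ S)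
    (h : pauliOp p * pauliOp g = -(pauliOp g * pauliOp p)) :
    codeProj e * pauliOp p * codeProj e = 0 := by
  have h1 : codeProj e * pauliOp p * codeProj e = -(codeProj e * pauliOp p * codeProj e) := by
    have hr : pauliOp g * codeProj e = codeProj e := he.mul_codeProj_of_mem hg
    calc codeProj e * pauliOp p * codeProj e
        = codeProj e * (pauliOp p * pauliOp g) * codeProj e := by
          rw [← mul_assoc, mul_assoc _ (pauliOp g), hr]
      _ = -(codeProj e * pauliOp g * pauliOp p * codeProj e) := by
          rw [h, mul_neg, neg_mul, mul_assoc (codeProj e) (pauliOp g)]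
      _ = _ := by rw [he.codeProj_mul_pauliOp hg]
  have h2 : (2 : ℂ) • (codeProj e * pauliOp p * codeProj e) = 0 := by
    rw [two_smul]
    exact add_eq_zero_iff_eq_neg.mpr h1
  exact (smul_eq_zero.mp h2).resolve_left two_ne_zero

lemma ne_zero (b : Fin 2) : e b ≠ 0 := by
  intro h
  have := he.orthonormal b b
  rw [h] at this
  simp at this

lemma trace_codeProj : (codeProj e).trace = 2 := by
  rw [codeProj, encodedDiag, Matrix.trace_sum, Fin.sum_univ_two]
  simp only [Pi.one_apply, one_smul, Matrix.trace_vecMulVec]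
  rw [dotProduct_comm, he.orthonormal, dotProduct_comm, he.orthonormal]
  norm_num

lemma finrank_codeSpace : Module.finrank ℂ (codeSpace S) = 2 := by
  have hspan : codeSpace S = Submodule.span ℂ (Set.range e) := by
    refine le_antisymm (fun ψ hψ => ?_) (Submodule.span_le.mpr ?_)
    · obtain ⟨c, rfl⟩ := he.span ψ hψ
      exact Submodule.sum_mem _ fun b _ =>
        Submodule.smul_mem _ _ (Submodule.subset_span ⟨b, rfl⟩)
    · rintro _ ⟨b, rfl⟩
      exact he.mem b
  have hli : LinearIndependent ℂ e := by
    rw [Fintype.linearIndependent_iff]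
    intro c hc b
    have := congrArg (fun ψ => star (e b) ⬝ᵥ ψ) hc
    simpa only [dotProduct_sum, dotProduct_smul, he.orthonormal, smul_eq_mul, mul_ite, mul_one,
      mul_zero, Finset.sum_ite_eq, Finset.mem_univ, if_true, dotProduct_zero] using this
  rw [hspan, finrank_span_eq_card hli, Fintype.card_fin]

lemma codeProj_mul_codeState {ρ : Op Q} (hρ : IsCodeState S ρ) : codeProj e * ρ = ρ :=
  he.codeProj_mul hρ.2

open scoped ComplexOrder in
lemma codeState_mul_codeProj {ρ : Op Q} (hρ : IsCodeState S ρ) : ρ * codeProj e = ρ := by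
  have h := congrArg Matrix.conjTranspose (he.codeProj_mul_codeState hρ)
  rwa [Matrix.conjTranspose_mul, conjTranspose_codeProj, hρ.1.1.isHermitian.eq] at h

omit he in
open scoped ComplexOrder in
/-- Unit vectors in the code space define code states. -/
lemma isCodeState_vecMulVec {ψ : Vec Q} (hψ : ψ ∈ codeSpace S) (h1 : star ψ ⬝ᵥ ψ = 1) :
    IsCodeState S (Matrix.vecMulVec ψ (star ψ)) := by
  refine ⟨⟨Matrix.posSemidef_vecMulVec_self_star ψ, ?_⟩, fun v => ?_⟩
  · rw [Matrix.trace_vecMulVec, dotProduct_comm, h1]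
  · rw [Matrix.vecMulVec_mulVec, op_smul_eq_smul]
    exact Submodule.smul_mem _ _ hψ

lemma plusState_mem : plusState e ∈ codeSpace S :=
  Submodule.smul_mem _ _ (Submodule.add_mem _ (he.mem 0) (he.mem 1))

/-- With `d = 1` this normalizes the plus state; with `d = bitSign` it shows that the encoded `Z`
has mean zero there. -/
lemma star_plusState_dotProduct_encodedDiag (d : Fin 2 → ℂ) :
    star (plusState e) ⬝ᵥ (encodedDiag e d *ᵥ plusState e) = (d 0 + d 1) / 2 := by
  rw [plusState, Matrix.mulVec_smul, Matrix.mulVec_add, he.encodedDiag_mulVec_basis,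
    he.encodedDiag_mulVec_basis, star_smul, smul_dotProduct, dotProduct_smul, star_add,
    add_dotProduct, dotProduct_add, dotProduct_add]
  simp only [dotProduct_smul, he.orthonormal]
  rw [smul_smul, star_inv₀, Complex.star_def, Complex.conj_ofReal, inv_sqrt_two_mul_self]
  simp
  ring

lemma star_plusState_dotProduct : star (plusState e) ⬝ᵥ plusState e = 1 := by
  have h := he.star_plusState_dotProduct_encodedDiag 1
  rw [← codeProj, he.codeProj_mulVec he.plusState_mem] at h
  simpa using h

end IsCodeBasis

/-- The code detects all Pauli errors on at most two qubits. -/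
def DetectsWeightTwo (e : Fin 2 → Vec Q) : Prop :=
  ∀ p : Q → Pauli, pauliWeight p ≤ 2 → p ≠ (fun _ => Pauli.I) →
    codeProj e * pauliOp p * codeProj e = 0

/-- The Knill–Laflamme condition: of the Pauli strings in `A` only the identity survives. It
disposes of `H0` and of the products `L† L`. -/
lemma IsCodeBasis.exists_codeProj_mul_mul_codeProj_eq_smul {e : Fin 2 → Vec Q}
    (he : IsCodeBasis S e) (hdet : DetectsWeightTwo e) {A : Op Q} (hA : A ∈ kLocal Q 2) :
    ∃ c : ℂ, codeProj e * A * codeProj e = c • codeProj e := by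
  induction hA using Submodule.span_induction with
  | mem A hA =>
    obtain ⟨p, hp, rfl⟩ := hA
    by_cases h : p = fun _ => Pauli.I
    · refine ⟨1, ?_⟩
      rw [h, pauliOp_I, mul_one, he.codeProj_mul_codeProj, one_smul]
    · exact ⟨0, by rw [hdet p hp h, zero_smul]⟩
  | zero => exact ⟨0, by simp⟩
  | add A B _ _ hA hB =>
    obtain ⟨a, ha⟩ := hA
    obtain ⟨b, hb⟩ := hB
    exact ⟨a + b, by rw [mul_add, add_mul, ha, hb, add_smul]⟩
  | smul c A _ hA =>
    obtain ⟨a, ha⟩ := hA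
    exact ⟨c * a, by rw [Matrix.mul_smul, Matrix.smul_mul, ha, smul_smul]⟩

lemma singleQubitOp_mem_kLocal (q : Q) (A : Matrix (Fin 2) (Fin 2) ℂ) :
    singleQubitOp q A ∈ kLocal Q 2 := by
  rw [singleQubitOp_eq_sum]
  exact Submodule.sum_mem _ fun p _ => Submodule.smul_mem _ _
    (Submodule.subset_span ⟨_, (pauliWeight_pauliAt_le q p).trans (by norm_num), rfl⟩)

lemma conjTranspose_singleQubitOp (q : Q) (A : Matrix (Fin 2) (Fin 2) ℂ) :
    (singleQubitOp q A)ᴴ = singleQubitOp q Aᴴ := by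
  ext x y
  simp only [singleQubitOp, tensorOp, Matrix.conjTranspose_apply, Matrix.of_apply, star_prod]
  refine Finset.prod_congr rfl fun r _ => ?_
  by_cases h : r = q
  · subst h
    simp [Matrix.conjTranspose_apply]
  · simp only [Function.update_of_ne h]
    rw [← Matrix.conjTranspose_apply, Matrix.conjTranspose_one]

lemma singleQubitOp_mul (q : Q) (A B : Matrix (Fin 2) (Fin 2) ℂ) :
    singleQubitOp q A * singleQubitOp q B = singleQubitOp q (A * B) := by
  rw [singleQubitOp, singleQubitOp, singleQubitOp, tensorOp_mul]
  congr 1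
  funext r
  by_cases h : r = q
  · subst h
    simp
  · simp [Function.update_of_ne h]

end EncodedQubit

/-! ### The thin surface code -/

section ThinCode

variable {m : ℕ}

lemma plaquette_mem_thinSurfaceCode (r : Fin 2) (j : Fin (m + 1)) :
    pauliUnit (pauliOn .X (plaquette r j)) ∈ thinSurfaceCode m :=
  Subgroup.subset_closure (Or.inl ⟨(r, j), rfl⟩)

lemma vertexStar_mem_thinSurfaceCode (s : Fin 3) (c : Fin m) :
    pauliUnit (pauliOn .Z (vertexStar s c)) ∈ thinSurfaceCode m :=
  Subgroup.subset_closure (Or.inr ⟨(s, c), rfl⟩)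

lemma mem_codeSpace_closure {Q : Type} [Fintype Q] [DecidableEq Q] {G : Set (Op Q)ˣ} {ψ : Vec Q}
    (h : ∀ g ∈ G, (g : Op Q) *ᵥ ψ = ψ) : ψ ∈ codeSpace (Subgroup.closure G) := by
  intro s hs
  induction hs using Subgroup.closure_induction with
  | mem g hg => exact h g hg
  | one => exact Matrix.one_mulVec ψ
  | mul a b _ _ ha hb => rw [Units.val_mul, ← Matrix.mulVec_mulVec, hb, ha]
  | inv a _ ha =>
    conv_lhs => rw [← ha]
    rw [Matrix.mulVec_mulVec, Units.inv_mul, Matrix.one_mulVec]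

/-- `X` on a set translates bit strings and `Z` multiplies by a parity sign, so plaquettes impose
invariance and stars restrict the support. -/
lemma mem_codeSpace_thinSurfaceCode {ψ : Vec (ThinQubit m)} :
    ψ ∈ codeSpace (thinSurfaceCode m) ↔ (∀ r j x, ψ (x + bits (plaquette r j)) = ψ x) ∧
      ∀ s c x, ∑ q ∈ vertexStar s c, x q ≠ 0 → ψ x = 0 := by
  constructor
  · intro h
    refine ⟨fun r j x => ?_, fun s c x hx => ?_⟩
    · have h1 := h _ (plaquette_mem_thinSurfaceCode r j)
      change pauliOp _ *ᵥ ψ = ψ at h1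
      rw [pauliOn_X_mulVec] at h1
      exact congrFun h1 x
    · have h1 := h _ (vertexStar_mem_thinSurfaceCode s c)
      change pauliOp _ *ᵥ ψ = ψ at h1
      rw [pauliOn_Z_mulVec] at h1
      have h2 := congrFun h1 x
      rw [bit_ne_zero hx, bitSign_one, neg_one_mul] at h2
      exact neg_eq_self.mp h2
  · rintro ⟨hX, hZ⟩
    refine mem_codeSpace_closure ?_
    rintro _ (⟨⟨r, j⟩, rfl⟩ | ⟨⟨s, c⟩, rfl⟩)
    · change pauliOp _ *ᵥ ψ = ψ
      rw [pauliOn_X_mulVec]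
      exact funext (hX r j)
    · change pauliOp _ *ᵥ ψ = ψ
      rw [pauliOn_Z_mulVec]
      funext x
      by_cases hx : ∑ q ∈ vertexStar s c, x q = 0
      · rw [hx, bitSign_zero, one_mul]
      · rw [hZ s c x hx, mul_zero]

/-- The cycles with a given column parity. -/
def IsCycle (x : ThinQubit m → Fin 2) (b : Fin 2) : Prop :=
  (∀ s c, ∑ q ∈ vertexStar s c, x q = 0) ∧ ∑ q ∈ column 0, x q = b

instance (x : ThinQubit m → Fin 2) (b : Fin 2) : Decidable (IsCycle x b) := by
  unfold IsCycle; infer_instance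

/-- A cycle with a given column parity. -/
def cycleRep (m : ℕ) (b : Fin 2) : ThinQubit m → Fin 2 := if b = 0 then 0 else bits (lastRow m)

lemma isCycle_cycleRep (b : Fin 2) : IsCycle (cycleRep m b) b := by
  unfold cycleRep
  split_ifs with hb
  · exact ⟨fun s c => by simp, by simp [hb]⟩
  · exact ⟨sum_vertexStar_bits_lastRow, by rw [sum_column_bits_lastRow, bit_ne_zero hb]⟩

lemma isCycle_add_plaquette {x : ThinQubit m → Fin 2} {b : Fin 2} (r : Fin 2) (j : Fin (m + 1)) :
    IsCycle (x + bits (plaquette r j)) b ↔ IsCycle x b := by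
  simp only [IsCycle, Pi.add_apply, Finset.sum_add_distrib, sum_vertexStar_bits_plaquette,
    sum_column_bits_plaquette, add_zero]

/-- The equal superposition of the cycles with a given column parity, as a unit vector. -/
noncomputable def logicalState (m : ℕ) (b : Fin 2) : Vec (ThinQubit m) := fun x =>
  if IsCycle x b then ((Real.sqrt (Fintype.card {x : ThinQubit m → Fin 2 // IsCycle x b}))⁻¹ : ℝ)
    else 0

lemma card_isCycle_pos (b : Fin 2) :
    0 < Fintype.card {x : ThinQubit m → Fin 2 // IsCycle x b} :=
  Fintype.card_pos_iff.mpr ⟨⟨cycleRep m b, isCycle_cycleRep b⟩⟩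

/-- By `cycle_eq_sum` a cycle differs from its representative by plaquettes, under which `ψ` is
invariant. -/
lemma apply_eq_apply_cycleRep {ψ : Vec (ThinQubit m)} (hψ : ψ ∈ codeSpace (thinSurfaceCode m))
    {x : ThinQubit m → Fin 2} {b : Fin 2} (hx : IsCycle x b) : ψ x = ψ (cycleRep m b) := by
  have hX := (mem_codeSpace_thinSurfaceCode.mp hψ).1
  obtain ⟨g, hg⟩ := cycle_eq_sum hx.1
  rw [hx.2] at hg
  have key : ∀ (s : Finset (Fin 2 × Fin (m + 1))) (y : ThinQubit m → Fin 2),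
      ψ ((fun q => ∑ f ∈ s, if q ∈ plaquette f.1 f.2 then g f else 0) + y) = ψ y := by
    intro s
    induction s using Finset.induction_on with
    | empty => intro y; congr 1; funext q; simp
    | insert f s hf ih =>
      intro y
      have hsplit : (fun q => ∑ f ∈ insert f s, if q ∈ plaquette f.1 f.2 then g f else 0) + y =
          (fun q => ∑ f ∈ s, if q ∈ plaquette f.1 f.2 then g f else 0) +
            (y + fun q => if q ∈ plaquette f.1 f.2 then g f else 0) := by
        funext q
        simp only [Pi.add_apply, Finset.sum_insert hf]
        abel
      rw [hsplit, ih]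
      by_cases h0 : g f = 0
      · congr 1
        funext q
        simp [h0]
      · rw [bit_ne_zero h0]
        exact hX f.1 f.2 y
  rw [hg]
  exact key _ _

lemma isCodeBasis_logicalState (m : ℕ) : IsCodeBasis (thinSurfaceCode m) (logicalState m) where
  mem b := by
    refine mem_codeSpace_thinSurfaceCode.mpr ⟨fun r j x => ?_, fun s c x hx => ?_⟩
    · simp only [logicalState, isCycle_add_plaquette]
    · exact if_neg fun h => hx (h.1 s c)
  orthonormal a b := by
    have hmul : ∀ x, star (logicalState m a) x * logicalState m b x =
        if a = b then (if IsCycle x b then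
          ((Fintype.card {x : ThinQubit m → Fin 2 // IsCycle x b} : ℂ))⁻¹ else 0) else 0 := by
      intro x
      by_cases hab : a = b
      · subst hab
        rw [if_pos rfl, Pi.star_apply, logicalState]
        split_ifs with h
        · rw [Complex.star_def, Complex.conj_ofReal, ← Complex.ofReal_mul, ← mul_inv,
            Real.mul_self_sqrt (Nat.cast_nonneg _)]
          push_cast
          rfl
        · simp
      · rw [if_neg hab, Pi.star_apply, logicalState, logicalState]
        by_cases h : IsCycle x a
        · have h' : ¬ IsCycle x b := fun h' => hab (h.2.symm.trans h'.2)
          rw [if_neg h', mul_zero]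
        · rw [if_neg h, star_zero, zero_mul]
    simp only [dotProduct, hmul]
    split_ifs with hab
    · rw [Finset.sum_ite, Finset.sum_const_zero, add_zero, Finset.sum_const, nsmul_eq_mul,
        ← Fintype.card_subtype]
      exact mul_inv_cancel₀ (Nat.cast_ne_zero.mpr (card_isCycle_pos b).ne')
    · simp
  span ψ hψ := by
    -- The square root undoes the normalization of `logicalState`.
    refine ⟨fun b => ψ (cycleRep m b) *
      Real.sqrt (Fintype.card {x : ThinQubit m → Fin 2 // IsCycle x b}), ?_⟩
    funext x
    rw [Finset.sum_apply]
    simp only [Pi.smul_apply, smul_eq_mul, logicalState]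
    by_cases hx : ∀ s c, ∑ q ∈ vertexStar s c, x q = 0
    · rw [Finset.sum_eq_single (∑ q ∈ column 0, x q)]
      · rw [if_pos ⟨hx, rfl⟩, mul_assoc, ← Complex.ofReal_mul, mul_inv_cancel₀, Complex.ofReal_one,
          mul_one]
        · exact apply_eq_apply_cycleRep hψ ⟨hx, rfl⟩
        · exact (Real.sqrt_pos.mpr (Nat.cast_pos.mpr (card_isCycle_pos _))).ne'
      · intro b _ hb
        rw [if_neg fun h => hb h.2.symm, mul_zero]
      · simp
    · rw [Finset.sum_eq_zero fun b _ => by rw [if_neg fun h => hx h.1, mul_zero]]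
      push Not at hx
      obtain ⟨s, c, hsc⟩ := hx
      exact (mem_codeSpace_thinSurfaceCode.mp hψ).2 s c x hsc

/-- The `Z` operator of each column acts as the encoded `Z`. -/
lemma pauliOn_column_mul_codeProj (j : Fin (m + 1)) :
    pauliOp (pauliOn .Z (column j)) * codeProj (logicalState m) = encodedZ (logicalState m) := by
  have he := isCodeBasis_logicalState m
  rw [← he.encodedZ_mul_codeProj]
  refine IsCodeBasis.mul_codeProj_eq_of_basis fun b => ?_
  rw [encodedZ, he.encodedDiag_mulVec_basis, pauliOn_Z_mulVec]
  funext x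
  rw [Pi.smul_apply, smul_eq_mul]
  by_cases hx : IsCycle x b
  · rw [sum_column_eq_of_cycle hx.1, hx.2]
  · simp [logicalState, hx]

/-! #### Normalizer and stabilizer group -/

lemma zBit_pauliOn_Z {Q : Type} [DecidableEq Q] (T : Finset Q) (q : Q) :
    (pauliOn .Z T q).zBit = bits T q := by
  unfold pauliOn bits; split_ifs <;> rfl

lemma xBit_pauliOn_Z {Q : Type} [DecidableEq Q] (T : Finset Q) (q : Q) :
    (pauliOn .Z T q).xBit = 0 := by
  unfold pauliOn; split_ifs <;> rfl

lemma xBit_pauliOn_X {Q : Type} [DecidableEq Q] (T : Finset Q) (q : Q) :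
    (pauliOn .X T q).xBit = bits T q := by
  unfold pauliOn bits; split_ifs <;> rfl

lemma zBit_pauliOn_X {Q : Type} [DecidableEq Q] (T : Finset Q) (q : Q) :
    (pauliOn .X T q).zBit = 0 := by
  unfold pauliOn; split_ifs <;> rfl

lemma commute_of_commute_generators {p : ThinQubit m → Pauli}
    (hX : ∀ r j, ∑ q ∈ plaquette r j, (p q).zBit = 0)
    (hZ : ∀ s c, ∑ q ∈ vertexStar s c, (p q).xBit = 0) :
    ∀ s ∈ thinSurfaceCode m, Commute (pauliUnit p) s := by
  intro s hs
  induction hs using Subgroup.closure_induction with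
  | mem g hg =>
    rcases hg with ⟨⟨r, j⟩, rfl⟩ | ⟨⟨s, c⟩, rfl⟩
    · have h := pauliOp_mul_pauliOn_X p (plaquette r j)
      rw [hX, bitSign_zero, one_smul] at h
      exact Units.ext h
    · have h := pauliOp_mul_pauliOn_Z p (vertexStar s c)
      rw [hZ, bitSign_zero, one_smul] at h
      exact Units.ext h
  | one => exact Commute.one_right _
  | mul a b _ _ ha hb => exact ha.mul_right hb
  | inv a _ ha => exact ha.inv_right

lemma mem_normalizer_of_commutes {p : ThinQubit m → Pauli}
    (hX : ∀ r j, ∑ q ∈ plaquette r j, (p q).zBit = 0)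
    (hZ : ∀ s c, ∑ q ∈ vertexStar s c, (p q).xBit = 0) :
    pauliUnit p ∈ Subgroup.normalizer (thinSurfaceCode m : Set (Op (ThinQubit m))ˣ) := by
  refine Subgroup.centralizer_le_normalizer _ ?_
  rw [Subgroup.mem_centralizer_iff]
  intro s hs
  exact (commute_of_commute_generators hX hZ s hs).symm

/-- Otherwise conjugation by `p` would put `-g` into `S`, and a code vector fixed by both `g` and
`-g` is zero. -/
lemma not_anticommute_of_mem_normalizer {Q : Type} [Fintype Q] [DecidableEq Q]
    {S : Subgroup (Op Q)ˣ} {e : Fin 2 → Vec Q} (he : IsCodeBasis S e) {p g : Q → Pauli}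
    (hp : pauliUnit p ∈ Subgroup.normalizer (S : Set (Op Q)ˣ)) (hg : pauliUnit g ∈ S) :
    pauliOp p * pauliOp g ≠ -(pauliOp g * pauliOp p) := by
  intro h
  have h1 := (Subgroup.mem_normalizer_iff.mp hp _).mp hg
  have h2 := he.mem 0 _ h1
  have h3 : ((pauliUnit p * pauliUnit g * (pauliUnit p)⁻¹ : (Op Q)ˣ) : Op Q) = -pauliOp g := by
    change pauliOp p * pauliOp g * pauliOp p = _
    rw [h, neg_mul, mul_assoc, pauliOp_mul_self, mul_one]
  have h4 : pauliOp g *ᵥ e 0 = e 0 := he.mem 0 _ hg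
  rw [h3, Matrix.neg_mulVec, h4] at h2
  refine he.ne_zero 0 ?_
  funext x
  exact neg_eq_self.mp (congrFun h2 x)

lemma commutes_of_mem_normalizer {p : ThinQubit m → Pauli}
    (hp : pauliUnit p ∈ Subgroup.normalizer (thinSurfaceCode m : Set (Op (ThinQubit m))ˣ)) :
    (∀ r j, ∑ q ∈ plaquette r j, (p q).zBit = 0) ∧
      ∀ s c, ∑ q ∈ vertexStar s c, (p q).xBit = 0 := by
  have he := isCodeBasis_logicalState m
  constructor
  · intro r j
    by_contra h0
    have h := pauliOp_mul_pauliOn_X p (plaquette r j)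
    rw [bit_ne_zero h0, bitSign_one, neg_one_smul] at h
    exact not_anticommute_of_mem_normalizer he hp (plaquette_mem_thinSurfaceCode r j) h
  · intro s c
    by_contra h0
    have h := pauliOp_mul_pauliOn_Z p (vertexStar s c)
    rw [bit_ne_zero h0, bitSign_one, neg_one_smul] at h
    exact not_anticommute_of_mem_normalizer he hp (vertexStar_mem_thinSurfaceCode s c) h

/-- The logical `X` on the last row commutes with all stabilizers and their multiples, but
anticommutes with `Z` on a column. -/
lemma pauliOn_column_ne_smul (j : Fin (m + 1)) (c : ℂ) {s : (Op (ThinQubit m))ˣ}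
    (hs : s ∈ thinSurfaceCode m) : pauliOp (pauliOn .Z (column j)) ≠ c • (s : Op (ThinQubit m)) := by
  intro h
  have hcomm := commute_of_commute_generators (p := pauliOn .X (lastRow m))
    (fun r j => Finset.sum_eq_zero fun q _ => zBit_pauliOn_X _ q)
    (fun s c => by simp only [xBit_pauliOn_X]; exact sum_vertexStar_bits_lastRow s c) s hs
  have hcomm' : pauliOp (pauliOn .X (lastRow m)) * (s : Op (ThinQubit m)) =
      s * pauliOp (pauliOn .X (lastRow m)) := congrArg Units.val hcomm
  have hanti := pauliOp_mul_pauliOn_Z (pauliOn .X (lastRow m)) (column j)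
  simp only [xBit_pauliOn_X, sum_column_bits_lastRow, bitSign_one, neg_one_smul] at hanti
  rw [h, Matrix.mul_smul, hcomm', ← Matrix.smul_mul, ← h] at hanti
  have hne : pauliOp (pauliOn .Z (column j)) * pauliOp (pauliOn .X (lastRow m)) ≠ 0 :=
    (pauliUnit (pauliOn .Z (column j)) * pauliUnit (pauliOn .X (lastRow m))).ne_zero
  refine hne ?_
  ext x y
  exact self_eq_neg.mp (congrFun (congrFun hanti x) y)

lemma pauliOn_column_mem_normalizer (j : Fin (m + 1)) :
    pauliUnit (pauliOn .Z (column j)) ∈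
      Subgroup.normalizer (thinSurfaceCode m : Set (Op (ThinQubit m))ˣ) :=
  mem_normalizer_of_commutes
    (fun r i => by simp only [zBit_pauliOn_Z]; exact sum_plaquette_bits_column r i j)
    (fun s c => Finset.sum_eq_zero fun q _ => xBit_pauliOn_Z _ q)

lemma pauliOn_mem_thinSurfaceCode {T : Finset (ThinQubit m)}
    (ht : ∀ r j, ∑ q ∈ plaquette r j, bits T q = 0) (h0 : ∑ q ∈ lastRow m, bits T q = 0) :
    pauliUnit (pauliOn .Z T) ∈ thinSurfaceCode m := by
  obtain ⟨f, hf⟩ := cocycle_eq_sum ht h0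
  rw [pauliOn_eq_pauliBits, hf]
  exact pauliUnit_pauliBits_sum_mem (T := fun v : Fin 3 × Fin m => vertexStar v.1 v.2)
    (fun v => vertexStar_mem_thinSurfaceCode v.1 v.2) f

lemma detectsWeightTwo_logicalState (hm : 2 ≤ m) : DetectsWeightTwo (logicalState m) := by
  intro p hp hpI
  have he := isCodeBasis_logicalState m
  by_cases hX : ∀ r j, ∑ q ∈ plaquette r j, (p q).zBit = 0
  · by_cases hZ : ∀ s c, ∑ q ∈ vertexStar s c, (p q).xBit = 0
    · exact absurd (eq_I_of_commutes hm hp hX hZ) hpI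
    · push Not at hZ
      obtain ⟨s, c, h0⟩ := hZ
      have h := pauliOp_mul_pauliOn_Z p (vertexStar s c)
      rw [bit_ne_zero h0, bitSign_one, neg_one_smul] at h
      exact he.codeProj_mul_mul_codeProj_eq_zero (vertexStar_mem_thinSurfaceCode s c) h
  · push Not at hX
    obtain ⟨r, j, h0⟩ := hX
    have h := pauliOp_mul_pauliOn_X p (plaquette r j)
    rw [bit_ne_zero h0, bitSign_one, neg_one_smul] at h
    exact he.codeProj_mul_mul_codeProj_eq_zero (plaquette_mem_thinSurfaceCode r j) h

lemma thinSurfaceCode_le_pauliGroup : thinSurfaceCode m ≤ pauliGroup (ThinQubit m) := by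
  refine (Subgroup.closure_le _).mpr ?_
  rintro _ (⟨f, rfl⟩ | ⟨v, rfl⟩) <;> exact Subgroup.subset_closure (Or.inl ⟨_, rfl⟩)

lemma thinSurfaceCode_comm {a b : (Op (ThinQubit m))ˣ} (ha : a ∈ thinSurfaceCode m)
    (hb : b ∈ thinSurfaceCode m) : a * b = b * a := by
  change Commute a b
  induction ha using Subgroup.closure_induction with
  | mem g hg =>
    rcases hg with ⟨⟨r, j⟩, rfl⟩ | ⟨⟨s, c⟩, rfl⟩
    · refine commute_of_commute_generators (fun r j => Finset.sum_eq_zero fun q _ =>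
        zBit_pauliOn_X _ q) (fun s c => ?_) b hb
      simp only [xBit_pauliOn_X]
      exact sum_vertexStar_bits_plaquette s c r j
    · refine (commute_of_commute_generators (fun r j => ?_) (fun s c => Finset.sum_eq_zero
        fun q _ => xBit_pauliOn_Z _ q) b hb)
      have h := sum_vertexStar_bits_plaquette s c r j
      simp only [zBit_pauliOn_Z]
      simp only [bits, Finset.sum_ite_mem] at h ⊢
      rwa [Finset.inter_comm]
  | one => exact Commute.one_left _
  | mul a b _ _ ha hb => exact ha.mul_left hb
  | inv a _ ha => exact ha.inv_left

theorem isStabilizerCode_thinSurfaceCode (hm : 2 ≤ m) :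
    IsStabilizerCode (thinSurfaceCode m) (5 * m + 3) 1 3 := by
  refine ⟨?_, thinSurfaceCode_le_pauliGroup, fun a ha b hb => thinSurfaceCode_comm ha hb, ?_, ?_, ?_⟩
  · simp only [Fintype.card_sum, Fintype.card_prod, Fintype.card_fin]
    ring
  · rw [(isCodeBasis_logicalState m).finrank_codeSpace, pow_one]
  · refine ⟨pauliOn .Z (column 0), ?_, pauliOn_column_mem_normalizer 0,
      fun c s hs => pauliOn_column_ne_smul 0 c hs⟩
    refine (congrArg Finset.card ?_).trans (card_column (0 : Fin (m + 1)))
    ext q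
    simp [pauliOn]
  · rintro w ⟨p, rfl, hp, hpS⟩
    by_contra! hw
    obtain ⟨hX, hZ⟩ := commutes_of_mem_normalizer hp
    refine hpS 1 1 (Subgroup.one_mem _) ?_
    rw [eq_I_of_commutes hm (by omega) hX hZ, pauliOp_I, one_smul, Units.val_one]

theorem zzzLogicals_thinSurfaceCode (m : ℕ) : zzzLogicals (thinSurfaceCode m) =
    Set.range (column : Fin (m + 1) → Finset (ThinQubit m)) := by
  ext T
  constructor
  · rintro ⟨hT, hnorm, hmem⟩
    have ht := (commutes_of_mem_normalizer hnorm).1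
    simp only [zBit_pauliOn_Z] at ht
    obtain ⟨j, rfl⟩ := eq_column_of_cocycle hT ht fun h0 => hmem (pauliOn_mem_thinSurfaceCode ht h0)
    exact ⟨j, rfl⟩
  · rintro ⟨j, rfl⟩
    refine ⟨card_column j, pauliOn_column_mem_normalizer j, fun h => ?_⟩
    exact pauliOn_column_ne_smul j 1 h (by rw [one_smul]; rfl)

theorem ncard_zzzLogicals (m : ℕ) : (zzzLogicals (thinSurfaceCode m)).ncard = m + 1 := by
  rw [zzzLogicals_thinSurfaceCode, ← Set.image_univ, Set.ncard_image_of_injective _ column_injective,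
    Set.ncard_univ, Nat.card_eq_fintype_card, Fintype.card_fin]

/-- The projection of the three-body interaction onto the code space. -/
theorem codeProj_mul_zzzInteraction_mul_codeProj (m : ℕ) : ∃ a : ℂ,
    codeProj (logicalState m) * zzzInteraction (ThinQubit m) * codeProj (logicalState m) =
      a • codeProj (logicalState m) + ((m : ℂ) + 1) • encodedZ (logicalState m) := by
  have he := isCodeBasis_logicalState m
  -- Three cases: a column acts as the encoded `Z`; any other cocycle is a stabilizer and
  -- contributes the projection; a set that is not a cocycle is detected by a plaquette and
  -- contributes 0.
  have hterm : ∀ T ∈ Finset.powersetCard 3 (Finset.univ : Finset (ThinQubit m)), ∃ a : ℂ,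
      codeProj (logicalState m) * pauliOp (pauliOn .Z T) * codeProj (logicalState m) =
        a • codeProj (logicalState m) +
          if T ∈ Finset.univ.image (column : Fin (m + 1) → _) then encodedZ (logicalState m)
          else 0 := by
    intro T hT
    have hcard : T.card = 3 := (Finset.mem_powersetCard.mp hT).2
    split_ifs with hcol
    · obtain ⟨j, -, rfl⟩ := Finset.mem_image.mp hcol
      refine ⟨0, ?_⟩
      rw [mul_assoc, pauliOn_column_mul_codeProj, he.codeProj_mul_encodedZ, zero_smul, zero_add]
    · by_cases ht : ∀ r j, ∑ q ∈ plaquette r j, bits T q = 0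
      · have h0 : ∑ q ∈ lastRow m, bits T q = 0 := by
          by_contra h0
          obtain ⟨j, rfl⟩ := eq_column_of_cocycle hcard ht h0
          exact hcol (Finset.mem_image_of_mem _ (Finset.mem_univ j))
        refine ⟨1, ?_⟩
        rw [he.codeProj_mul_pauliOp (pauliOn_mem_thinSurfaceCode ht h0),
          he.codeProj_mul_codeProj, one_smul, add_zero]
      · push Not at ht
        obtain ⟨r, j, h0⟩ := ht
        have h := pauliOp_mul_pauliOn_X (pauliOn .Z T) (plaquette r j)
        simp only [zBit_pauliOn_Z] at h
        rw [bit_ne_zero h0, bitSign_one, neg_one_smul] at h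
        refine ⟨0, ?_⟩
        rw [he.codeProj_mul_mul_codeProj_eq_zero (plaquette_mem_thinSurfaceCode r j) h,
          zero_smul, add_zero]
  choose! a ha using hterm
  refine ⟨∑ T ∈ Finset.powersetCard 3 (Finset.univ : Finset (ThinQubit m)), a T, ?_⟩
  have hsub : Finset.univ.image (column : Fin (m + 1) → Finset (ThinQubit m)) ⊆
      Finset.powersetCard 3 Finset.univ := by
    intro T hT
    obtain ⟨j, -, rfl⟩ := Finset.mem_image.mp hT
    exact Finset.mem_powersetCard.mpr ⟨Finset.subset_univ _, card_column j⟩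
  rw [zzzInteraction, Finset.mul_sum, Finset.sum_mul, Finset.sum_congr rfl ha,
    Finset.sum_add_distrib, ← Finset.sum_smul, Finset.sum_ite_mem,
    Finset.inter_eq_right.mpr hsub, Finset.sum_const,
    Finset.card_image_of_injective _ column_injective, Finset.card_univ, Fintype.card_fin,
    ← Nat.cast_smul_eq_nsmul ℂ, Nat.cast_add, Nat.cast_one]

end ThinCode

/-! ### Recovery operations -/

section RecoveryOperation

variable {Q : Type} [Fintype Q] [DecidableEq Q] {S : Subgroup (Op Q)ˣ} {e : Fin 2 → Vec Q}

/-- Used in both directions: to verify that the constructed recovery corrects errors, and to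
evaluate an arbitrary recovery on a quantum jump. -/
lemma krausMap_mul_mul_conjTranspose {κ : ℕ} {K : Fin κ → Op Q} {E ρ : Op Q} {α : Fin κ → ℂ}
    (hK : ∀ i, K i * E * codeProj e = α i • codeProj e) (hl : codeProj e * ρ = ρ)
    (hr : ρ * codeProj e = ρ) : krausMap K (E * ρ * Eᴴ) = (∑ i, α i * star (α i)) • ρ := by
  rw [krausMap, Finset.sum_smul]
  refine Finset.sum_congr rfl fun i _ => ?_
  have h1 : K i * E * ρ = α i • ρ := by rw [← hl, ← mul_assoc, hK, Matrix.smul_mul]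
  have h2 : ρ * (Eᴴ * (K i)ᴴ) = star (α i) • ρ := by
    have h := congrArg Matrix.conjTranspose (hK i)
    rw [Matrix.conjTranspose_mul, Matrix.conjTranspose_mul, Matrix.conjTranspose_smul,
      conjTranspose_codeProj] at h
    rw [← hr, mul_assoc, h, Matrix.mul_smul]
  calc K i * (E * ρ * Eᴴ) * (K i)ᴴ = K i * E * ρ * (Eᴴ * (K i)ᴴ) := by simp only [mul_assoc]
    _ = (α i * star (α i)) • ρ := by rw [h1, Matrix.smul_mul, h2, smul_smul]

lemma trace_krausMap {κ : ℕ} {K : Fin κ → Op Q} (hK : ∑ i, (K i)ᴴ * K i = 1) (X : Op Q) :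
    (krausMap K X).trace = X.trace := by
  rw [krausMap, Matrix.trace_sum]
  simp only [fun i => Matrix.trace_mul_comm (K i * X) (K i)ᴴ, ← mul_assoc]
  rw [← Matrix.trace_sum, ← Finset.sum_mul, hK, one_mul]

lemma krausMap_add {κ : ℕ} (K : Fin κ → Op Q) (X Y : Op Q) :
    krausMap K (X + Y) = krausMap K X + krausMap K Y := by
  simp only [krausMap, mul_add, add_mul, Finset.sum_add_distrib]

lemma krausMap_smul {κ : ℕ} (K : Fin κ → Op Q) (c : ℂ) (X : Op Q) :
    krausMap K (c • X) = c • krausMap K X := by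
  simp only [krausMap, Matrix.mul_smul, Matrix.smul_mul, Finset.smul_sum]

/-! #### Existence -/

section Existence

variable (he : IsCodeBasis S e) (hdet : DetectsWeightTwo e)
include he hdet

/-- The product of two distinct errors on at most one qubit each is a nontrivial string on at most
two, hence detected: the errors carry the code to mutually orthogonal subspaces. -/
lemma codeProj_mul_pauliOp_mul_pauliOp {p q : Q → Pauli} (hp : pauliWeight p ≤ 1)
    (hq : pauliWeight q ≤ 1) : codeProj e * pauliOp p * (pauliOp q * codeProj e) =
      if p = q then codeProj e else 0 := by
  split_ifs with h
  · subst h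
    rw [mul_assoc, ← mul_assoc (pauliOp p), pauliOp_mul_self, one_mul, he.codeProj_mul_codeProj]
  · rw [mul_assoc, ← mul_assoc (pauliOp p), pauliOp_mul_pauliOp, Matrix.smul_mul, Matrix.mul_smul,
      ← mul_assoc, hdet _ ((pauliWeight_mulLabel_le p q).trans (by omega)), smul_zero]
    intro h'
    exact h (funext fun r => Pauli.eq_of_mulLabel_eq_I (congrFun h' r))

/-- Syndrome decoding: `T` projects onto the sum of the orthogonal error spaces, on each of which
the error is undone. The complement is reset to `e 0`, which makes the channel trace preserving. -/
theorem nonempty_recovery : Nonempty (Recovery S) := by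
  let W := {p : Q → Pauli // pauliWeight p ≤ 1}
  set P := codeProj e
  have hPP : P * P = P := he.codeProj_mul_codeProj
  have hPh : Pᴴ = P := conjTranspose_codeProj e
  have horth : ∀ p q : W, P * pauliOp p.1 * (pauliOp q.1 * P) = if p = q then P else 0 := by
    intro p q
    rw [codeProj_mul_pauliOp_mul_pauliOp he hdet p.2 q.2]
    exact if_congr Subtype.ext_iff.symm rfl rfl
  let T : Op Q := ∑ p : W, (pauliOp p.1 * P) * (P * pauliOp p.1)
  have hTq : ∀ q : W, T * (pauliOp q.1 * P) = pauliOp q.1 * P := by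
    intro q
    simp only [T, Finset.sum_mul, mul_assoc (pauliOp _ * P) _ (pauliOp q.1 * P), horth, mul_ite,
      mul_zero, Finset.sum_ite_eq', Finset.mem_univ, if_true]
    rw [mul_assoc, hPP]
  have hTT : T * T = T := by
    conv_lhs => rw [show T * T = ∑ p : W, T * ((pauliOp p.1 * P) * (P * pauliOp p.1)) from
      Finset.mul_sum _ _ _]
    exact Finset.sum_congr rfl fun q _ => by rw [← mul_assoc, hTq]
  have hTh : Tᴴ = T := by
    simp only [T, Matrix.conjTranspose_sum, Matrix.conjTranspose_mul, hPh, conjTranspose_pauliOp]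
  let K : W ⊕ (Q → Fin 2) → Op Q := Sum.elim (fun p => P * pauliOp p.1)
    fun x => Matrix.vecMulVec (e 0) (Pi.single x 1) * (1 - T)
  have hKK : ∑ i, (K i)ᴴ * K i = 1 := by
    rw [Fintype.sum_sum_type]
    have h1 : ∑ p : W, (K (.inl p))ᴴ * K (.inl p) = T := by
      refine Finset.sum_congr rfl fun p _ => ?_
      simp only [K, Sum.elim_inl, Matrix.conjTranspose_mul, hPh, conjTranspose_pauliOp]
    have h2 : ∑ x : Q → Fin 2, (K (.inr x))ᴴ * K (.inr x) = 1 - T := by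
      have h3 : ∀ x : Q → Fin 2, (K (.inr x))ᴴ * K (.inr x) =
          (1 - T) * Matrix.single x x 1 * (1 - T) := by
        intro x
        have hs : star (Pi.single x 1 : Vec Q) = Pi.single x 1 := by
          funext y
          simp [Pi.single_apply, apply_ite]
        simp only [K, Sum.elim_inr, Matrix.conjTranspose_mul, Matrix.conjTranspose_vecMulVec,
          Matrix.conjTranspose_sub, Matrix.conjTranspose_one, hTh, hs]
        rw [mul_assoc, ← mul_assoc (Matrix.vecMulVec (Pi.single x 1) _),
          Matrix.vecMulVec_mul_vecMulVec, he.orthonormal, if_pos rfl, one_smul,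
          Matrix.single_eq_single_vecMulVec_single, ← mul_assoc]
      simp only [h3]
      rw [← Finset.sum_mul, ← Finset.mul_sum]
      have h4 : ∑ x : Q → Fin 2, Matrix.single x x (1 : ℂ) = 1 := by
        rw [Matrix.sum_single_eq_diagonal, Matrix.diagonal_one]
      rw [h4, mul_one, mul_sub, sub_mul, sub_mul, hTT]
      simp
    rw [h1, h2, add_sub_cancel]
  let ε := Fintype.equivFin (W ⊕ (Q → Fin 2))
  refine ⟨⟨Fintype.card (W ⊕ (Q → Fin 2)), fun i => K (ε.symm i), ?_, ?_, ?_⟩⟩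
  · rw [Equiv.sum_comp ε.symm fun i => (K i)ᴴ * K i, hKK]
  · intro i v
    generalize ε.symm i = k
    rcases k with p | x
    · simp only [K, Sum.elim_inl]
      rw [← Matrix.mulVec_mulVec]
      exact he.codeProj_mulVec_mem _
    · simp only [K, Sum.elim_inr]
      rw [← Matrix.mulVec_mulVec, Matrix.vecMulVec_mulVec, op_smul_eq_smul]
      exact Submodule.smul_mem _ _ (he.mem 0)
  · intro q A
    have hα : ∀ k, ∃ α : ℂ, K k * singleQubitOp q A * P = α • P := by
      intro k
      have hsum : singleQubitOp q A * P = ∑ p, Pauli.coeff A p • (pauliOp (pauliAt q p) * P) := by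
        rw [singleQubitOp_eq_sum, Finset.sum_mul]
        simp only [Matrix.smul_mul]
      rcases k with p | x
      · refine ⟨∑ a, Pauli.coeff A a * if p = ⟨pauliAt q a, pauliWeight_pauliAt_le q a⟩ then 1
          else 0, ?_⟩
        simp only [K, Sum.elim_inl]
        rw [mul_assoc, hsum, Finset.mul_sum, Finset.sum_smul]
        refine Finset.sum_congr rfl fun a _ => ?_
        rw [Matrix.mul_smul, horth p ⟨pauliAt q a, pauliWeight_pauliAt_le q a⟩, mul_smul]
        split_ifs <;> simp
      · refine ⟨0, ?_⟩
        simp only [K, Sum.elim_inr]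
        rw [mul_assoc, hsum, mul_assoc, Finset.mul_sum, zero_smul]
        rw [Finset.sum_eq_zero, mul_zero]
        intro a _
        rw [Matrix.mul_smul, sub_mul, one_mul, hTq ⟨pauliAt q a, pauliWeight_pauliAt_le q a⟩,
          sub_self, smul_zero]
    choose α hα using hα
    exact ⟨_, fun ρ hρ => krausMap_mul_mul_conjTranspose (e := e) (fun i => hα (ε.symm i))
      (he.codeProj_mul_codeState hρ) (he.codeState_mul_codeProj hρ)⟩

end Existence

/-! #### Structure -/

section Structure

variable (he : IsCodeBasis S e) (R : Recovery S)
include he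

/-- A Kraus operator of a recovery acts after a correctable error as a scalar. -/
lemma recovery_mul_singleQubitOp_mul_codeProj (q : Q) (A : Matrix (Fin 2) (Fin 2) ℂ)
    (i : Fin R.κ) : ∃ α : ℂ, R.K i * singleQubitOp q A * codeProj e = α • codeProj e := by
  obtain ⟨c, hc⟩ := R.corrects q A
  set E := singleQubitOp q A
  -- Testing the corrected state against `w` gives a vanishing sum of squared moduli over the Kraus
  -- operators, so each term vanishes.
  have horth : ∀ ψ ∈ codeSpace S, star ψ ⬝ᵥ ψ = 1 → ∀ w : Vec Q, star w ⬝ᵥ ψ = 0 →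
      star w ⬝ᵥ ((R.K i * E) *ᵥ ψ) = 0 := by
    intro ψ hψ h1 w hw
    have h2 := hc _ (IsCodeBasis.isCodeState_vecMulVec hψ h1)
    have hterm : ∀ k, R.K k * (E * Matrix.vecMulVec ψ (star ψ) * Eᴴ) * (R.K k)ᴴ =
        Matrix.vecMulVec ((R.K k * E) *ᵥ ψ) (star ((R.K k * E) *ᵥ ψ)) := by
      intro k
      rw [Matrix.star_mulVec, ← Matrix.mul_vecMulVec, ← Matrix.vecMulVec_mul,
        Matrix.conjTranspose_mul]
      simp only [mul_assoc]
    have h3 := congrArg (fun X : Op Q => star w ⬝ᵥ (X *ᵥ w)) h2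
    simp only [krausMap, hterm, Matrix.sum_mulVec, dotProduct_sum, Matrix.smul_mulVec,
      Matrix.vecMulVec_mulVec, op_smul_eq_smul, dotProduct_smul, hw, smul_eq_mul,
      mul_zero] at h3
    have h4 : ∀ v : Vec Q, star v ⬝ᵥ w * star w ⬝ᵥ v = ((Complex.normSq (star w ⬝ᵥ v) : ℝ) : ℂ) := by
      intro v
      rw [Complex.normSq_eq_conj_mul_self, starRingEnd_apply, Matrix.star_dotProduct]
    simp only [h4] at h3
    rw [← Complex.ofReal_sum] at h3
    have h5 := (Finset.sum_eq_zero_iff_of_nonneg fun k _ => Complex.normSq_nonneg _).mp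
      (Complex.ofReal_eq_zero.mp h3) i (Finset.mem_univ i)
    exact Complex.normSq_eq_zero.mp h5
  have heig : ∀ ψ ∈ codeSpace S, star ψ ⬝ᵥ ψ = 1 → ∃ a : ℂ, (R.K i * E) *ᵥ ψ = a • ψ := by
    intro ψ hψ h1
    set v := (R.K i * E) *ᵥ ψ with hv
    refine ⟨star ψ ⬝ᵥ v, ?_⟩
    set w := v - (star ψ ⬝ᵥ v) • ψ with hw
    have hwψ' : star ψ ⬝ᵥ w = 0 := by
      rw [hw, dotProduct_sub, dotProduct_smul, h1, smul_eq_mul, mul_one, sub_self]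
    have hwψ : star w ⬝ᵥ ψ = 0 := by
      rw [Matrix.star_dotProduct, hwψ', star_zero]
    have hww : star w ⬝ᵥ w = 0 := by
      conv_lhs => rw [hw]
      rw [← hw, dotProduct_sub, dotProduct_smul, hwψ, horth ψ hψ h1 w hwψ, smul_zero, sub_zero]
    have hw0 : w = 0 := by
      open scoped ComplexOrder in
      exact dotProduct_star_self_eq_zero.mp hww
    exact sub_eq_zero.mp hw0
  obtain ⟨a, ha⟩ := heig _ (he.mem 0) (he.orthonormal 0 0)
  obtain ⟨b, hb⟩ := heig _ (he.mem 1) (he.orthonormal 1 1)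
  -- Every unit code vector is an eigenvector; the superposition forces the eigenvalues on both
  -- basis vectors to agree.
  obtain ⟨d, hd⟩ := heig _ he.plusState_mem he.star_plusState_dotProduct
  have hs : ((Real.sqrt 2 : ℂ))⁻¹ ≠ 0 := by
    intro h
    have h2 := inv_sqrt_two_mul_self
    rw [h] at h2
    norm_num at h2
  rw [plusState, Matrix.mulVec_smul, smul_comm d] at hd
  have hd' := smul_right_injective _ hs hd
  rw [Matrix.mulVec_add, ha, hb] at hd'
  have had : a = d := by
    simpa [dotProduct_add, dotProduct_smul, he.orthonormal] using
      congrArg (fun v => star (e 0) ⬝ᵥ v) hd'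
  have hbd : b = d := by
    simpa [dotProduct_add, dotProduct_smul, he.orthonormal] using
      congrArg (fun v => star (e 1) ⬝ᵥ v) hd'
  refine ⟨d, ?_⟩
  rw [IsCodeBasis.mul_codeProj_eq_of_basis (e := e) (B := d • 1), Matrix.smul_mul, one_mul]
  intro k
  rw [Matrix.smul_mulVec, Matrix.one_mulVec]
  fin_cases k
  · exact had ▸ ha
  · exact hbd ▸ hb

lemma codeProj_mul_recovery (i : Fin R.κ) : codeProj e * R.K i = R.K i :=
  he.codeProj_mul (R.range_mem i)

variable [Nonempty Q]

/-- The identity is itself a correctable error once there is a qubit. The second identity is trace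
preservation multiplied from the left by the projection. -/
lemma exists_recovery_mul_codeProj : ∃ β : Fin R.κ → ℂ,
    (∀ i, R.K i * codeProj e = β i • codeProj e) ∧ ∑ i, star (β i) • R.K i = codeProj e := by
  have h : ∀ i, ∃ β : ℂ, R.K i * codeProj e = β • codeProj e := by
    intro i
    obtain ⟨β, hβ⟩ := recovery_mul_singleQubitOp_mul_codeProj he R (Classical.arbitrary Q) 1 i
    refine ⟨β, ?_⟩
    have h1 : singleQubitOp (Classical.arbitrary Q) 1 = (1 : Op Q) := by
      rw [singleQubitOp, Function.update_eq_self_iff.mpr rfl, tensorOp_one]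
    rwa [h1, mul_one] at hβ
  choose β hβ using h
  refine ⟨β, hβ, ?_⟩
  have h2 := congrArg (codeProj e * ·) R.tracePreserving
  simp only [Finset.mul_sum, mul_one] at h2
  rw [← h2]
  refine Finset.sum_congr rfl fun i _ => ?_
  have h3 := congrArg Matrix.conjTranspose (hβ i)
  rw [Matrix.conjTranspose_mul, Matrix.conjTranspose_smul, conjTranspose_codeProj] at h3
  rw [← mul_assoc, h3, Matrix.smul_mul, codeProj_mul_recovery he]

/-- A recovery projects one-sided perturbations of code states onto the code space. -/
lemma krausMap_mul_right {ρ : Op Q} (hr : ρ * codeProj e = ρ) (A : Op Q) :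
    krausMap R.K (A * ρ) = codeProj e * A * ρ := by
  obtain ⟨β, hβ, hsum⟩ := exists_recovery_mul_codeProj he R
  rw [krausMap, ← hsum, Finset.sum_mul, Finset.sum_mul]
  refine Finset.sum_congr rfl fun i _ => ?_
  have h3 := congrArg Matrix.conjTranspose (hβ i)
  rw [Matrix.conjTranspose_mul, Matrix.conjTranspose_smul, conjTranspose_codeProj] at h3
  conv_lhs => rw [← hr]
  rw [mul_assoc, mul_assoc, mul_assoc, h3, Matrix.mul_smul, Matrix.mul_smul, Matrix.mul_smul, hr,
    Matrix.smul_mul, Matrix.smul_mul, mul_assoc]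

lemma krausMap_mul_left {ρ : Op Q} (hl : codeProj e * ρ = ρ) (A : Op Q) :
    krausMap R.K (ρ * A) = ρ * A * codeProj e := by
  have h1 : (krausMap R.K (Aᴴ * ρᴴ))ᴴ = krausMap R.K (ρ * A) := by
    simp only [krausMap, Matrix.conjTranspose_sum, Matrix.conjTranspose_mul,
      Matrix.conjTranspose_conjTranspose, mul_assoc]
  have h2 : ρᴴ * codeProj e = ρᴴ := by
    conv_lhs => rw [← conjTranspose_codeProj e, ← Matrix.conjTranspose_mul, hl]
  rw [← h1, krausMap_mul_right he R h2]
  simp only [Matrix.conjTranspose_mul, Matrix.conjTranspose_conjTranspose, conjTranspose_codeProj,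
    mul_assoc]

lemma krausMap_eq_self {ρ : Op Q} (hl : codeProj e * ρ = ρ) (hr : ρ * codeProj e = ρ) :
    krausMap R.K ρ = ρ := by
  have := krausMap_mul_right he R hr 1
  rwa [one_mul, mul_one, hl] at this

/-- A recovery removes the dissipative part of the dynamics. -/
lemma krausMap_dissipator (hdet : DetectsWeightTwo e) {L : Op Q} {q : Q}
    {A : Matrix (Fin 2) (Fin 2) ℂ} (hL : L = singleQubitOp q A) {ρ : Op Q}
    (hl : codeProj e * ρ = ρ) (hr : ρ * codeProj e = ρ) :
    krausMap R.K (L * ρ * Lᴴ - (1 / 2 : ℂ) • (Lᴴ * L * ρ + ρ * (Lᴴ * L))) = 0 := by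
  obtain ⟨c, hc⟩ : ∃ c : ℂ, ∀ ρ : Op Q, codeProj e * ρ = ρ → ρ * codeProj e = ρ →
      krausMap R.K (L * ρ * Lᴴ) = c • ρ := by
    have h := recovery_mul_singleQubitOp_mul_codeProj he R q A
    rw [← hL] at h
    choose α hα using h
    exact ⟨_, fun ρ => krausMap_mul_mul_conjTranspose hα⟩
  obtain ⟨a, ha⟩ : ∃ a : ℂ, codeProj e * (Lᴴ * L) * codeProj e = a • codeProj e := by
    refine he.exists_codeProj_mul_mul_codeProj_eq_smul hdet ?_
    rw [hL, conjTranspose_singleQubitOp, singleQubitOp_mul]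
    exact singleQubitOp_mem_kLocal _ _
  have hPP := he.codeProj_mul_codeProj
  -- Both constants are fixed by traces, as the recovery preserves the trace; this is why jump and
  -- decay terms cancel.
  have hca : c = a := by
    have h1 := congrArg Matrix.trace (hc _ hPP hPP)
    have h2 := congrArg Matrix.trace ha
    rw [trace_krausMap R.tracePreserving, Matrix.trace_mul_comm, ← mul_assoc] at h1
    rw [mul_assoc, Matrix.trace_mul_comm, mul_assoc, hPP, h1, Matrix.trace_smul, Matrix.trace_smul,
      he.trace_codeProj] at h2
    exact mul_right_cancel₀ two_ne_zero h2
  have h1 : krausMap R.K (Lᴴ * L * ρ) = a • ρ := by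
    rw [krausMap_mul_right he R hr, ← hl, ← mul_assoc, ha, Matrix.smul_mul]
  have h2 : krausMap R.K (ρ * (Lᴴ * L)) = a • ρ := by
    rw [krausMap_mul_left he R hl, ← hr, mul_assoc, mul_assoc, ← mul_assoc (codeProj e), ha,
      Matrix.mul_smul]
  rw [sub_eq_add_neg, ← neg_smul, krausMap_add, krausMap_smul, krausMap_add, h1, h2,
    hc ρ hl hr, hca]
  module

/-- Under a recovery, only the encoded part of the signal Hamiltonian acts on code states. -/
theorem krausMap_lindbladian (hdet : DetectsWeightTwo e) {a g : ℂ}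
    (hG : codeProj e * zzzInteraction Q * codeProj e = a • codeProj e + g • encodedZ e)
    (N : NoiseModel Q) (ω : ℝ) {ρ : Op Q} (hl : codeProj e * ρ = ρ) (hr : ρ * codeProj e = ρ) :
    krausMap R.K (lindbladian N ω ρ) =
      (-Complex.I * (ω * g)) • (encodedZ e * ρ - ρ * encodedZ e) := by
  obtain ⟨b, hb⟩ := he.exists_codeProj_mul_mul_codeProj_eq_smul hdet N.H0_mem
  have hH : codeProj e * hamiltonian N ω * codeProj e =
      ((ω : ℂ) * a + b) • codeProj e + ((ω : ℂ) * g) • encodedZ e := by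
    rw [hamiltonian, mul_add, add_mul, hb, Matrix.mul_smul, Matrix.smul_mul, hG]
    module
  have h1 : krausMap R.K (hamiltonian N ω * ρ) =
      ((ω : ℂ) * a + b) • ρ + ((ω : ℂ) * g) • (encodedZ e * ρ) := by
    rw [krausMap_mul_right he R hr]
    conv_lhs => rw [← hl]
    rw [← mul_assoc, hH, add_mul, Matrix.smul_mul, Matrix.smul_mul, hl]
  have h2 : krausMap R.K (ρ * hamiltonian N ω) =
      ((ω : ℂ) * a + b) • ρ + ((ω : ℂ) * g) • (ρ * encodedZ e) := by
    rw [krausMap_mul_left he R hl]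
    conv_lhs => rw [← hr]
    rw [mul_assoc, mul_assoc, ← mul_assoc (codeProj e), hH, mul_add, Matrix.mul_smul,
      Matrix.mul_smul, hr]
  have hsum : ∀ (s : Finset (Fin N.r)) (F : Fin N.r → Op Q), (∀ k, krausMap R.K (F k) = 0) →
      krausMap R.K (∑ k ∈ s, F k) = 0 := by
    intro s F hF
    induction s using Finset.induction_on with
    | empty => simp [krausMap]
    | insert k s hk ih => rw [Finset.sum_insert hk, krausMap_add, hF, ih, add_zero]
  rw [lindbladian, krausMap_add, hsum, add_zero, krausMap_smul, sub_eq_add_neg (_ * ρ),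
    ← neg_one_smul ℂ (ρ * _), krausMap_add, krausMap_smul, h1, h2]
  · module
  · intro k
    obtain ⟨q, A, hL⟩ := N.L_local k
    exact krausMap_dissipator he R hdet hL hl hr

end Structure

end RecoveryOperation

/-! ### Dynamics of the encoded qubit in the fast control limit -/

section EncodedRotation

variable {Q : Type} {e : Fin 2 → Vec Q}

/-- The encoded unitary operator `exp (-i θ Z)`. -/
noncomputable def encodedPhase (e : Fin 2 → Vec Q) (θ : ℝ) : Op Q :=
  (Real.cos θ : ℂ) • codeProj e - (Complex.I * Real.sin θ) • encodedZ e

lemma conjTranspose_encodedPhase (θ : ℝ) : (encodedPhase e θ)ᴴ =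
    (Real.cos θ : ℂ) • codeProj e + (Complex.I * Real.sin θ) • encodedZ e := by
  rw [encodedPhase, Matrix.conjTranspose_sub, Matrix.conjTranspose_smul, Matrix.conjTranspose_smul,
    conjTranspose_codeProj, conjTranspose_encodedZ]
  simp only [Complex.star_def, Complex.conj_ofReal, map_mul, Complex.conj_I]
  module

variable [Fintype Q] [DecidableEq Q] {S : Subgroup (Op Q)ˣ}

/-- The conjugation of `ρ` by `exp (-i θ Z)`, for the encoded Pauli operator `Z`. -/
noncomputable def encodedRotation (e : Fin 2 → Vec Q) (θ : ℝ) (ρ : Op Q) : Op Q :=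
  ((1 + Complex.cos ((2 * θ : ℝ) : ℂ)) / 2) • ρ +
    (Complex.I * Complex.sin ((2 * θ : ℝ) : ℂ) / 2) • (ρ * encodedZ e - encodedZ e * ρ) +
    ((1 - Complex.cos ((2 * θ : ℝ) : ℂ)) / 2) • (encodedZ e * ρ * encodedZ e)

/-- True for every `ρ`, whereas conjugation by `encodedPhase e 0` would compress `ρ` to the code
space. -/
lemma encodedRotation_zero (ρ : Op Q) : encodedRotation e 0 ρ = ρ := by
  simp [encodedRotation]

variable (he : IsCodeBasis S e)
include he

lemma conjTranspose_encodedPhase_mul (θ : ℝ) :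
    (encodedPhase e θ)ᴴ * encodedPhase e θ = codeProj e := by
  have h : (Real.cos θ : ℂ) ^ 2 + (Real.sin θ : ℂ) ^ 2 = 1 := by
    exact_mod_cast Real.cos_sq_add_sin_sq θ
  push_cast at h
  rw [conjTranspose_encodedPhase, encodedPhase, add_mul, mul_sub, mul_sub]
  simp only [Matrix.smul_mul, Matrix.mul_smul, he.codeProj_mul_codeProj, he.codeProj_mul_encodedZ,
    he.encodedZ_mul_codeProj, he.encodedZ_mul_encodedZ, smul_smul]
  match_scalars
  · linear_combination h - (Complex.sin θ) ^ 2 * Complex.I_mul_I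
  · ring

lemma conjTranspose_encodedPhase_mul_encodedZ_mul (θ : ℝ) :
    (encodedPhase e θ)ᴴ * encodedZ e * encodedPhase e θ = encodedZ e := by
  have h1 : (encodedPhase e θ)ᴴ * encodedZ e = encodedZ e * (encodedPhase e θ)ᴴ := by
    rw [conjTranspose_encodedPhase, add_mul, mul_add]
    simp only [Matrix.smul_mul, Matrix.mul_smul, he.codeProj_mul_encodedZ,
      he.encodedZ_mul_codeProj]
  rw [h1, mul_assoc, conjTranspose_encodedPhase_mul he, he.encodedZ_mul_codeProj]

section Code

variable {ρ : Op Q} (hl : codeProj e * ρ = ρ) (hr : ρ * codeProj e = ρ)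
include hl hr

omit he in
lemma encodedRotation_eq (θ : ℝ) :
    encodedRotation e θ ρ = encodedPhase e θ * ρ * (encodedPhase e θ)ᴴ := by
  have hc : Complex.cos ((2 * θ : ℝ) : ℂ) = 2 * (Real.cos θ : ℂ) ^ 2 - 1 := by
    push_cast
    exact Complex.cos_two_mul _
  have hs : Complex.sin ((2 * θ : ℝ) : ℂ) = 2 * (Real.sin θ : ℂ) * Real.cos θ := by
    push_cast
    exact Complex.sin_two_mul _
  have h : (Real.sin θ : ℂ) ^ 2 = 1 - (Real.cos θ : ℂ) ^ 2 := by
    exact_mod_cast Real.sin_sq θ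
  push_cast at h
  rw [encodedRotation, conjTranspose_encodedPhase, encodedPhase, hc, hs]
  simp only [sub_mul, mul_add, Matrix.smul_mul, Matrix.mul_smul, hl, hr, mul_assoc,
    smul_smul]
  match_scalars
  · ring
  · ring
  · ring
  · linear_combination (Complex.sin θ) ^ 2 * Complex.I_mul_I - h

omit hr in
lemma codeProj_mul_encodedRotation (θ : ℝ) :
    codeProj e * encodedRotation e θ ρ = encodedRotation e θ ρ := by
  rw [encodedRotation]
  simp only [mul_add, mul_sub, Matrix.mul_smul, ← mul_assoc, hl, he.codeProj_mul_encodedZ]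

omit hl in
lemma encodedRotation_mul_codeProj (θ : ℝ) :
    encodedRotation e θ ρ * codeProj e = encodedRotation e θ ρ := by
  rw [encodedRotation]
  simp only [add_mul, sub_mul, Matrix.smul_mul, mul_assoc, hr, he.encodedZ_mul_codeProj]

open scoped Matrix.Norms.Elementwise in
-- The trigonometric form closes under the commutator with the encoded `Z`, because `Z² = P` and `P`
-- fixes `ρ` from both sides.
lemma hasDerivAt_encodedRotation (κ s : ℝ) :
    HasDerivAt (fun s : ℝ => encodedRotation e (s * κ) ρ)
      ((-Complex.I * κ) • (encodedZ e * encodedRotation e (s * κ) ρ -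
        encodedRotation e (s * κ) ρ * encodedZ e)) s := by
  have hlin : HasDerivAt (fun s : ℝ => ((2 * (s * κ) : ℝ) : ℂ)) ((2 * κ : ℝ) : ℂ) s := by
    have h := ((hasDerivAt_id s).mul_const κ).const_mul 2
    simp only [one_mul, id] at h
    exact h.ofReal_comp
  have hcos := (Complex.hasDerivAt_cos _).comp s hlin
  have hsin := (Complex.hasDerivAt_sin _).comp s hlin
  have h1 := ((hcos.const_add 1).div_const 2).smul_const ρ
  have h2 := ((hsin.const_mul Complex.I).div_const 2).smul_const
    (ρ * encodedZ e - encodedZ e * ρ)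
  have h3 := ((hcos.const_sub 1).div_const 2).smul_const (encodedZ e * ρ * encodedZ e)
  have h : HasDerivAt (fun s : ℝ => encodedRotation e (s * κ) ρ) _ s := (h1.add h2).add h3
  refine h.congr_deriv ?_
  have hZl : ∀ X : Op Q, encodedZ e * (encodedZ e * X) = codeProj e * X := fun X => by
    rw [← mul_assoc, he.encodedZ_mul_encodedZ]
  have hll : ∀ X : Op Q, codeProj e * (ρ * X) = ρ * X := fun X => by
    rw [← mul_assoc, hl]
  simp only [encodedRotation, mul_add, add_mul, mul_sub, sub_mul, Matrix.mul_smul, Matrix.smul_mul,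
    mul_assoc, hZl, hll, he.encodedZ_mul_encodedZ, hl, hr]
  match_scalars
  · linear_combination (-(κ : ℂ) * Complex.sin (2 * (s * κ))) * Complex.I_mul_I
  · ring
  · ring
  · linear_combination ((κ : ℂ) * Complex.sin (2 * (s * κ))) * Complex.I_mul_I

end Code

end EncodedRotation

section FastControl

variable {Q : Type} [Fintype Q] [DecidableEq Q] {S : Subgroup (Op Q)ˣ} {e : Fin 2 → Vec Q}

/-- The Lindbladian as a linear map. -/
noncomputable def lindbladianLinear (N : NoiseModel Q) (ω : ℝ) : Op Q →ₗ[ℝ] Op Q where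
  toFun := lindbladian N ω
  map_add' X Y := by
    have h : ∀ a, N.L a * (X + Y) * (N.L a)ᴴ -
        (1 / 2 : ℂ) • ((N.L a)ᴴ * N.L a * (X + Y) + (X + Y) * ((N.L a)ᴴ * N.L a)) =
        (N.L a * X * (N.L a)ᴴ - (1 / 2 : ℂ) • ((N.L a)ᴴ * N.L a * X + X * ((N.L a)ᴴ * N.L a))) +
        (N.L a * Y * (N.L a)ᴴ -
          (1 / 2 : ℂ) • ((N.L a)ᴴ * N.L a * Y + Y * ((N.L a)ᴴ * N.L a))) := by
      intro a
      rw [mul_add, add_mul, mul_add, add_mul]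
      module
    simp only [lindbladian, h, Finset.sum_add_distrib]
    rw [mul_add, add_mul]
    module
  map_smul' c X := by
    have h : ∀ a, N.L a * (c • X) * (N.L a)ᴴ -
        (1 / 2 : ℂ) • ((N.L a)ᴴ * N.L a * (c • X) + (c • X) * ((N.L a)ᴴ * N.L a)) =
        c • (N.L a * X * (N.L a)ᴴ -
          (1 / 2 : ℂ) • ((N.L a)ᴴ * N.L a * X + X * ((N.L a)ᴴ * N.L a))) := by
      intro a
      rw [Matrix.mul_smul, Matrix.smul_mul, Matrix.mul_smul, Matrix.smul_mul, smul_sub, ← smul_add,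
        smul_comm c]
    simp only [lindbladian, h, ← Finset.smul_sum, RingHom.id_apply]
    rw [Matrix.mul_smul, Matrix.smul_mul, ← smul_sub, smul_comm _ c, smul_add]

/-- A completely positive map in Kraus form as a linear map. -/
noncomputable def krausLinear {κ : ℕ} (K : Fin κ → Op Q) : Op Q →ₗ[ℝ] Op Q where
  toFun := krausMap K
  map_add' := krausMap_add K
  map_smul' c X := by
    simp only [krausMap, Matrix.mul_smul, Matrix.smul_mul, Finset.smul_sum, RingHom.id_apply]

/-- The compression to the code space as a linear map. -/
noncomputable def compressionLinear (e : Fin 2 → Vec Q) : Op Q →ₗ[ℝ] Op Q :=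
  LinearMap.mulLeft ℝ (codeProj e) ∘ₗ LinearMap.mulRight ℝ (codeProj e)

/-- In the fast control limit, the output state is obtained from the initial code state by an
encoded rotation. -/
theorem fastControlOutput_iff [Nonempty Q] (he : IsCodeBasis S e) (hdet : DetectsWeightTwo e)
    {a : ℂ} {g : ℝ}
    (hG : codeProj e * zzzInteraction Q * codeProj e = a • codeProj e + (g : ℂ) • encodedZ e)
    (N : NoiseModel Q) (R : Recovery S) (ω t : ℝ) {ρ : Op Q} (hl : codeProj e * ρ = ρ)
    (hr : ρ * codeProj e = ρ) (ρt : Op Q) :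
    FastControlOutput N R ω t ρ ρt ↔ ρt = encodedRotation e (t * (ω * g)) ρ := by
  have hP : ∀ X, compressionLinear e X = codeProj e * (X * codeProj e) := fun X => rfl
  have hPP := he.codeProj_mul_codeProj
  have hPK : ∀ X, compressionLinear e (krausLinear R.K X) = krausLinear R.K X := by
    intro X
    change codeProj e * (krausMap R.K X * codeProj e) = krausMap R.K X
    rw [krausMap, Finset.sum_mul, Finset.mul_sum]
    refine Finset.sum_congr rfl fun i _ => ?_
    have h := congrArg Matrix.conjTranspose (codeProj_mul_recovery he R i)
    rw [Matrix.conjTranspose_mul, conjTranspose_codeProj] at h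
    rw [mul_assoc, h, ← mul_assoc, ← mul_assoc, codeProj_mul_recovery he R i]
  have hKP : ∀ X, krausLinear R.K (compressionLinear e X) = compressionLinear e X := by
    intro X
    refine krausMap_eq_self he R ?_ ?_
    · rw [hP, ← mul_assoc, hPP]
    · rw [hP, mul_assoc, mul_assoc, hPP]
  have hfix : ∀ s : ℝ, compressionLinear e (encodedRotation e (s * (ω * g)) ρ) =
      encodedRotation e (s * (ω * g)) ρ := by
    intro s
    rw [hP, encodedRotation_mul_codeProj he hr, codeProj_mul_encodedRotation he hl]
  have hy : ∀ s : ℝ, HasDerivAt (fun s : ℝ => encodedRotation e (s * (ω * g)) ρ)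
      (krausLinear R.K (lindbladianLinear N ω (encodedRotation e (s * (ω * g)) ρ))) s := by
    intro s
    have h : krausLinear R.K (lindbladianLinear N ω (encodedRotation e (s * (ω * g)) ρ)) = _ :=
      krausMap_lindbladian he R hdet hG N ω
        (codeProj_mul_encodedRotation he hl _) (encodedRotation_mul_codeProj he hr _)
    rw [h, ← Complex.ofReal_mul]
    exact hasDerivAt_encodedRotation he hl hr (ω * g) s
  -- The norm is an auxiliary choice: the derivatives and limits involved depend only on the
  -- topology.
  have key := @exists_interrupted_run_iff (Op Q) Matrix.normedAddCommGroup Matrix.normedSpace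
    (FiniteDimensional.complete ℝ (Matrix (Q → Fin 2) (Q → Fin 2) ℂ))
    (inferInstanceAs (Module.Finite ℝ (Matrix (Q → Fin 2) (Q → Fin 2) ℂ)))
    (lindbladianLinear N ω) (krausLinear R.K) (compressionLinear e) hPK hKP
    (fun s : ℝ => encodedRotation e (s * (ω * g)) ρ) hy hfix t ρt
  simp only [zero_mul, encodedRotation_zero] at key
  exact key

end FastControl

/-! ### Quantum Fisher information -/

section FisherInformation

variable {Q : Type} [Fintype Q] [DecidableEq Q]

open scoped ComplexOrder in
/-- The quantum Fisher information of a family of states whose derivative is generated by `h` is at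
most four times the second moment of `h`. -/
lemma fisherInformation_le {ρ Λ h : Op Q} {F v : ℝ} (hρ : ρ.PosSemidef) (hΛ : Λ.IsHermitian)
    (hh : h.IsHermitian)
    (hD : (2 : ℂ) • ((-Complex.I) • (h * ρ - ρ * h)) = Λ * ρ + ρ * Λ)
    (hF : (F : ℂ) = (ρ * (Λ * Λ)).trace) (hv : (ρ * (h * h)).trace = v) : F ≤ 4 * v := by
  -- In `tr (B ρ B†) ≥ 0` the squares give `F + 4 v`, and the equation for `Λ` turns the cross terms
  -- into `-2 F`.
  set B := Λ + (2 * Complex.I) • h with hB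
  have hBH : Bᴴ = Λ - (2 * Complex.I) • h := by
    rw [hB, Matrix.conjTranspose_add, Matrix.conjTranspose_smul, hΛ.eq, hh.eq, sub_eq_add_neg,
      ← neg_smul]
    simp
  have hpos : 0 ≤ (B * ρ * Bᴴ).trace := (hρ.mul_mul_conjTranspose_same B).trace_nonneg
  have ht := congrArg (fun X => (X * Λ).trace) hD
  have h1 : (Λ * ρ * Λ).trace = F := by
    rw [mul_assoc, Matrix.trace_mul_comm, mul_assoc, hF]
  have h2 : (h * ρ * h).trace = v := by
    rw [mul_assoc, Matrix.trace_mul_comm, mul_assoc, hv]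
  have h3 : (Λ * ρ * h).trace = (ρ * h * Λ).trace := by
    rw [mul_assoc, Matrix.trace_mul_comm]
  simp only [Matrix.smul_mul, sub_mul, add_mul, Matrix.trace_smul, Matrix.trace_sub,
    Matrix.trace_add, h1, smul_eq_mul] at ht
  rw [mul_assoc ρ Λ Λ, ← hF] at ht
  have h4 : (B * ρ * Bᴴ).trace = ((4 * v - F : ℝ) : ℂ) := by
    rw [hBH, hB]
    simp only [add_mul, mul_sub, Matrix.smul_mul, Matrix.mul_smul, Matrix.trace_smul,
      Matrix.trace_sub, Matrix.trace_add, h1, h2, h3, smul_eq_mul]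
    push_cast
    linear_combination (-1 : ℂ) * ht - 4 * (v : ℂ) * Complex.I_mul_I
  rw [h4] at hpos
  have := Complex.zero_le_real.mp hpos
  linarith

/-- The symmetric logarithmic derivative and the quantum Fisher information of a pure state in which
the generator has mean zero. -/
lemma pure_fisherInformation {ρ Z P : Op Q} {s : ℝ} (hZ : Z.IsHermitian) (hρ : ρ.IsHermitian)
    (hZZ : Z * Z = P) (hl : P * ρ = ρ) (htr : ρ.trace = 1) (hρρ : ρ * ρ = ρ)
    (hmean : ρ * Z * ρ = 0) {D : Op Q} (hD : D = (-Complex.I * s) • (Z * ρ - ρ * Z)) :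
    ((2 : ℂ) • D).IsHermitian ∧ (2 : ℂ) • D = (2 : ℂ) • D * ρ + ρ * (2 : ℂ) • D ∧
      ((4 * s ^ 2 : ℝ) : ℂ) = (ρ * ((2 : ℂ) • D * (2 : ℂ) • D)).trace := by
  -- Differentiating `ρ² = ρ` suggests the choice `Λ = 2 D`. Since `ρ Z ρ = 0`, only the term with
  -- `Z² = P` survives in `tr (ρ Λ²)`.
  have h1 : ∀ X, ρ * (ρ * X) = ρ * X := fun X => by rw [← mul_assoc, hρρ]
  have h2 : ∀ X, ρ * (Z * (ρ * X)) = 0 := fun X => by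
    rw [← mul_assoc, ← mul_assoc, hmean, zero_mul]
  have h3 : ρ * (Z * ρ) = 0 := by rw [← mul_assoc, hmean]
  have h4 : ∀ X, Z * (Z * X) = P * X := fun X => by rw [← mul_assoc, hZZ]
  refine ⟨?_, ?_, ?_⟩
  · rw [Matrix.IsHermitian, hD]
    simp only [Matrix.conjTranspose_smul, Matrix.conjTranspose_sub, Matrix.conjTranspose_mul,
      hZ.eq, hρ.eq]
    simp only [Complex.star_def, map_mul, map_neg, Complex.conj_I, Complex.conj_ofReal, map_ofNat]
    module
  · rw [hD]
    simp only [Matrix.smul_mul, Matrix.mul_smul, sub_mul, mul_sub, mul_assoc, hρρ, h1, h3]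
    module
  · rw [hD]
    simp only [Matrix.smul_mul, Matrix.mul_smul, sub_mul, mul_sub, mul_assoc, hρρ, h1, h2, h3, h4,
      hl, mul_neg, Matrix.trace_smul, Matrix.trace_sub, Matrix.trace_zero, mul_zero, sub_zero, zero_sub,
      Matrix.trace_neg, htr, smul_eq_mul]
    push_cast
    linear_combination (4 * (s : ℂ) ^ 2) * Complex.I_mul_I

end FisherInformation

/-! ### The optimal initial state of the encoded qubit. -/

section OutputFisherInformation

variable {Q : Type} [Fintype Q] [DecidableEq Q] [Nonempty Q] {S : Subgroup (Op Q)ˣ}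
  {e : Fin 2 → Vec Q}

open scoped ComplexOrder Matrix.Norms.Elementwise in
/-- The output quantum Fisher information of an encoded qubit on which the signal acts with strength
`g`. -/
theorem isGreatest_outputQFIs (he : IsCodeBasis S e) (hdet : DetectsWeightTwo e) {a : ℂ} {g : ℝ}
    (hG : codeProj e * zzzInteraction Q * codeProj e = a • codeProj e + (g : ℂ) • encodedZ e)
    (N : NoiseModel Q) (R : Recovery S) (ω t : ℝ) :
    IsGreatest (outputQFIs N R ω t) (4 * (t * g) ^ 2) := by
  have hout : ∀ {ρ0 : Op Q}, IsCodeState S ρ0 → ∀ {ρ : ℝ → Op Q},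
      (∀ ω', FastControlOutput N R ω' t ρ0 (ρ ω')) ↔
        ρ = fun ω' => encodedRotation e (ω' * (t * g)) ρ0 := by
    intro ρ0 hρ0 ρ
    simp only [fastControlOutput_iff he hdet hG N R _ t (he.codeProj_mul_codeState hρ0)
      (he.codeState_mul_codeProj hρ0), funext_iff, mul_left_comm t]
  have hZ : (encodedZ e).IsHermitian := conjTranspose_encodedZ e
  constructor
  · set ψ := plusState e
    have h1 : star ψ ⬝ᵥ ψ = 1 := he.star_plusState_dotProduct
    set ρ0 := Matrix.vecMulVec ψ (star ψ) with hρ0_def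
    have hρ0 : IsCodeState S ρ0 := IsCodeBasis.isCodeState_vecMulVec he.plusState_mem h1
    have hl := he.codeProj_mul_codeState hρ0
    have hr := he.codeState_mul_codeProj hρ0
    refine ⟨ρ0, hρ0, fun ω' => encodedRotation e (ω' * (t * g)) ρ0, (hout hρ0).mpr rfl, ?_⟩
    have hd := hasDerivAt_encodedRotation he hl hr (t * g) ω
    set ρ := encodedRotation e (ω * (t * g)) ρ0 with hρ_def
    set A := encodedPhase e (ω * (t * g))
    have hA : ρ = A * ρ0 * Aᴴ := encodedRotation_eq hl hr _
    have hAA : Aᴴ * A = codeProj e := conjTranspose_encodedPhase_mul he _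
    have hAZA : Aᴴ * encodedZ e * A = encodedZ e :=
      conjTranspose_encodedPhase_mul_encodedZ_mul he _
    have hpure : ρ0 * ρ0 = ρ0 := by
      rw [hρ0_def, Matrix.vecMulVec_mul_vecMulVec, h1, one_smul]
    have hmean0 : ρ0 * encodedZ e * ρ0 = 0 := by
      rw [mul_assoc, hρ0_def, Matrix.mul_vecMulVec, Matrix.vecMulVec_mul_vecMulVec, encodedZ,
        he.star_plusState_dotProduct_encodedDiag]
      simp
    have hρH : ρ.IsHermitian := by
      rw [hA]
      exact (hρ0.1.1.mul_mul_conjTranspose_same A).isHermitian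
    have hρρ : ρ * ρ = ρ := by
      calc ρ * ρ = A * (ρ0 * (Aᴴ * A) * ρ0) * Aᴴ := by rw [hA]; simp only [mul_assoc]
        _ = ρ := by rw [hAA, hr, hpure, hA]
    have hmean : ρ * encodedZ e * ρ = 0 := by
      calc ρ * encodedZ e * ρ = A * (ρ0 * (Aᴴ * encodedZ e * A) * ρ0) * Aᴴ := by
            rw [hA]; simp only [mul_assoc]
        _ = 0 := by rw [hAZA, hmean0, mul_zero, zero_mul]
    have htr : ρ.trace = 1 := by
      rw [hA, Matrix.trace_mul_comm, ← mul_assoc, hAA, hl, hρ0.1.2]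
    obtain ⟨hΛ, hD, hF⟩ := pure_fisherInformation (s := t * g) hZ hρH he.encodedZ_mul_encodedZ
      (codeProj_mul_encodedRotation he hl _) htr hρρ hmean rfl
    exact ⟨_, _, hd, hΛ, hD, hF⟩
  · rintro F ⟨ρ0, hρ0, ρ, hρ, D, Λ, hD, hΛ, hSLD, hF⟩
    rw [hout hρ0] at hρ
    subst hρ
    have hl := he.codeProj_mul_codeState hρ0
    have hr := he.codeState_mul_codeProj hρ0
    have hd := hasDerivAt_encodedRotation he hl hr (t * g) ω
    have hDeq := hD.unique hd
    simp only at hSLD hF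
    set ρ := encodedRotation e (ω * (t * g)) ρ0 with hρ_def
    set A := encodedPhase e (ω * (t * g))
    have hA : ρ = A * ρ0 * Aᴴ := encodedRotation_eq hl hr _
    have hAA : Aᴴ * A = codeProj e := conjTranspose_encodedPhase_mul he _
    have htr : ρ.trace = 1 := by
      rw [hA, Matrix.trace_mul_comm, ← mul_assoc, hAA, hl, hρ0.1.2]
    -- The square of this generator is `(t g)²` times the projection, so its second moment is the
    -- same for every code state, pure or mixed.
    refine fisherInformation_le (h := ((t * g : ℝ) : ℂ) • encodedZ e)
      (hA ▸ hρ0.1.1.mul_mul_conjTranspose_same A) hΛ ?_ ?_ hF ?_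
    · rw [Matrix.IsHermitian, Matrix.conjTranspose_smul, hZ.eq, Complex.star_def,
        Complex.conj_ofReal]
    · rw [← hSLD, hDeq]
      simp only [Matrix.smul_mul, Matrix.mul_smul]
      module
    · simp only [Matrix.smul_mul, Matrix.mul_smul, he.encodedZ_mul_encodedZ, Matrix.trace_smul,
        hρ_def, encodedRotation_mul_codeProj he hr]
      rw [← hρ_def, htr]
      push_cast
      simp only [smul_eq_mul]
      ring

end OutputFisherInformation

/-! ### The Fisher information of the thin surface code. -/

section ThinCode

variable {m : ℕ}

theorem isGreatest_outputQFIs_thinSurfaceCode (hm : 2 ≤ m) (R : Recovery (thinSurfaceCode m))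
    (N : NoiseModel (ThinQubit m)) (ω t : ℝ) :
    IsGreatest (outputQFIs N R ω t) (4 * (t * (m + 1)) ^ 2) := by
  obtain ⟨a, ha⟩ := codeProj_mul_zzzInteraction_mul_codeProj m
  refine isGreatest_outputQFIs (isCodeBasis_logicalState m) (detectsWeightTwo_logicalState hm)
    (a := a) ?_ N R ω t
  rw [ha]
  push_cast
  rfl

theorem outputQFI_thinSurfaceCode (hm : 2 ≤ m) (R : Recovery (thinSurfaceCode m))
    (N : NoiseModel (ThinQubit m)) (ω t : ℝ) : outputQFI N R ω t = 4 * (t * (m + 1)) ^ 2 :=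
  (isGreatest_outputQFIs_thinSurfaceCode hm R N ω t).csSup_eq

end ThinCode

theorem theorem1 :
    -- for each `m ≥ 2`, with `n = 5 m + 3` qubits
    (∀ m n : ℕ, 2 ≤ m → n = 5 * m + 3 →
      IsStabilizerCode (thinSurfaceCode m) n 1 3 ∧
      ((zzzLogicals (thinSurfaceCode m)).ncard : ℝ) = ((n : ℝ) + 2) / 5 ∧
      Nonempty (Recovery (thinSurfaceCode m)) ∧
      ∀ (R : Recovery (thinSurfaceCode m)) (N : NoiseModel (ThinQubit m)) (t : ℝ), 0 ≤ t →
        (∀ (ω : ℝ) (ρ0 : Op (ThinQubit m)), IsCodeState (thinSurfaceCode m) ρ0 →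
          ∃ ρt, FastControlOutput N R ω t ρ0 ρt) ∧
        ∀ ω : ℝ, IsGreatest (outputQFIs N R ω t) (4 * ((n : ℝ) + 2) ^ 2 * t ^ 2 / 25) ∧
          outputQFI N R ω t = 4 * ((n : ℝ) + 2) ^ 2 * t ^ 2 / 25) ∧
    -- the output QFI is `Θ(n² t²)`, with constants that depend on nothing
    (∃ c C : ℝ, 0 < c ∧ 0 < C ∧ ∀ m n : ℕ, 2 ≤ m → n = 5 * m + 3 →
      ∀ (R : Recovery (thinSurfaceCode m)) (N : NoiseModel (ThinQubit m)) (ω t : ℝ), 0 ≤ t →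
        c * ((n : ℝ) ^ 2 * t ^ 2) ≤ outputQFI N R ω t ∧
        outputQFI N R ω t ≤ C * ((n : ℝ) ^ 2 * t ^ 2)) ∧
    -- Heisenberg limit
    (∀ m : ℕ, 2 ≤ m →
      ∀ (R : Recovery (thinSurfaceCode m)) (N : NoiseModel (ThinQubit m)) (ω : ℝ),
        (fun t : ℝ => outputQFI N R ω t) =Θ[atTop] fun t => t ^ 2) ∧
    -- Heisenberg scaling
    (∀ (R : ∀ m, Recovery (thinSurfaceCode (m + 2))) (N : ∀ m, NoiseModel (ThinQubit (m + 2)))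
      (ω t : ℝ), 0 < t →
        (fun m : ℕ => outputQFI (N m) (R m) ω t) =Θ[atTop]
          fun m => ((5 * (m + 2) + 3 : ℕ) : ℝ) ^ 2) := by
  have hQFI : ∀ m n : ℕ, n = 5 * m + 3 → ∀ t : ℝ,
      4 * ((n : ℝ) + 2) ^ 2 * t ^ 2 / 25 = 4 * (t * (m + 1)) ^ 2 := by
    rintro m n rfl t
    push_cast
    ring
  -- The constants come from `n² ≤ (n + 2)² ≤ (2 n)²`, the latter for `2 ≤ n`.
  refine ⟨?_, ⟨4 / 25, 16 / 25, by norm_num, by norm_num, ?_⟩, ?_, ?_⟩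
  · rintro m n hm hn
    refine ⟨hn ▸ isStabilizerCode_thinSurfaceCode hm, ?_,
      nonempty_recovery (isCodeBasis_logicalState m) (detectsWeightTwo_logicalState hm),
      fun R N t _ => ⟨fun ω ρ0 hρ0 => ?_, fun ω => ?_⟩⟩
    · rw [ncard_zzzLogicals, hn]
      push_cast
      ring
    · have he := isCodeBasis_logicalState m
      obtain ⟨a, ha⟩ := codeProj_mul_zzzInteraction_mul_codeProj m
      exact ⟨_, (fastControlOutput_iff he (detectsWeightTwo_logicalState hm) (a := a)
        (g := (m : ℝ) + 1) (by rw [ha]; push_cast; rfl) N R ω t (he.codeProj_mul_codeState hρ0)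
        (he.codeState_mul_codeProj hρ0) _).mpr rfl⟩
    · rw [hQFI m n hn]
      exact ⟨isGreatest_outputQFIs_thinSurfaceCode hm R N ω t,
        outputQFI_thinSurfaceCode hm R N ω t⟩
  · intro m n hm hn R N ω t _
    rw [outputQFI_thinSurfaceCode hm, ← hQFI m n hn]
    have hn2 : (2 : ℝ) ≤ n := by
      rw [hn]
      push_cast
      linarith [Nat.cast_nonneg (α := ℝ) m]
    constructor
    · have : (n : ℝ) ^ 2 * t ^ 2 ≤ ((n : ℝ) + 2) ^ 2 * t ^ 2 := by gcongr; linarith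
      linarith
    · have : ((n : ℝ) + 2) ^ 2 * t ^ 2 ≤ (2 * n : ℝ) ^ 2 * t ^ 2 := by gcongr; linarith
      linarith
  · intro m hm R N ω
    have h : (fun t : ℝ => outputQFI N R ω t) = fun t => (4 * ((m : ℝ) + 1) ^ 2) * t ^ 2 := by
      funext t
      rw [outputQFI_thinSurfaceCode hm]
      ring
    rw [h]
    have hc : (4 * ((m : ℝ) + 1) ^ 2) ≠ 0 := by positivity
    exact (isTheta_const_mul_left hc).mpr (isTheta_refl _ _)
  · intro R N ω t ht
    refine ⟨IsBigO.of_bound (16 / 25 * t ^ 2) (Eventually.of_forall fun m => ?_),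
      IsBigO.of_bound (25 / (4 * t ^ 2)) (Eventually.of_forall fun m => ?_)⟩
    all_goals
      rw [outputQFI_thinSurfaceCode (by omega), ← hQFI (m + 2) _ rfl,
        Real.norm_of_nonneg (by positivity), Real.norm_of_nonneg (by positivity)]
      set n : ℝ := ((5 * (m + 2) + 3 : ℕ) : ℝ) with hn
      have hn2 : (2 : ℝ) ≤ n := by
        rw [hn]
        push_cast
        linarith [Nat.cast_nonneg (α := ℝ) m]
    · have : (n + 2) ^ 2 * t ^ 2 ≤ (2 * n) ^ 2 * t ^ 2 := by gcongr; linarith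
      linarith
    · have : n ^ 2 ≤ (n + 2) ^ 2 := by gcongr; linarith
      have ht' : t ≠ 0 := ht.ne'
      calc n ^ 2 ≤ (n + 2) ^ 2 := this
        _ = 25 / (4 * t ^ 2) * (4 * (n + 2) ^ 2 * t ^ 2 / 25) := by field_simp
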